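/- Model. Non-uniform word RAM with words of $w=\Theta(\log m)$ bits, where $m$ is the size parameter: for every input size there may be a different program; every basic operation on words, every memory access, every access to a read-only input, every jump and every access to a table embedded in the program costs one step; the program counter fits into one word. $\tilde O(g(n))$ means $O(g(n)\cdot\log^{c} n)$ for some constant $c$. Random access data structures. Let $k\ge 0$ be an integer. An offline $k$-error random access data structure preprocesses a reference $R$ of length $m$ (over an integer alphabet with at least two symbols) and is then completed, with read-only access to $R$ and to a text $T$ of length $n$. The construction reports a support-length $h\in[0,n]$ such that, if $h<n$, then the suffix $T[n-h\,..\,n]$ of length $h+1$ is not a concatenation of at most $k$ symbols and at most $k+1$ (possibly empty) substrings of $R$. Afterwards it answers random access queries $i\in(n-h\,..\,n]$ by returning $T[i]$, with access to $R$ but not to $T$. Preprocessing time is not bounded. The construction time counts the steps after preprocessing; amortized query time $q$ and construction time $p$ mean that the construction followed by any sequence of $r$ queries takes at most $p+r\cdot q$ steps in total. Function inversion. A non-uniform function inversion data structure for functions $[N]\to[N]$ consists, for each $N$, of one query program (depending only on $N$), and of a stored memory content for each $f:[N]\to[N]$. From this content the program, with unit-cost access to $f$, answers every sequence of queries $y\in[N]$,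 each by an $x\in[N]$ with $f(x)=y$, or by reporting that no such $x$ exists. Statement. Let $\chi,\delta>0$ be constants with $\chi<1$. Assume that there is a (possibly non-uniform) offline $k$-error random access data structure with space complexity $O(m^{\chi})$ bits, amortized query time $\tilde O(m^{\delta})$, and construction time $\tilde O(m^{\chi+\delta})$ for texts of length at most $m^{\chi}\log m$. Then there is a non-uniform function inversion data structure that, for functions $[N]\to[N]$, has (worst-case) query time $\tilde O\bigl(N^{(\chi+\delta)/(1-\chi)}\bigr)$ and can be stored and queried in $\tilde O\bigl(N^{\chi/(1-\chi)}\bigr)$ space (on a word RAM with words of $\Theta(\log N)$ bits). -/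

import Mathlib

open Filter Asymptotics

/-! ### The non-uniform word RAM -/

/-- A machine word of `w` bits. -/
abbrev Word (w : ℕ) := Fin (2 ^ w)

/-- The contents of a memory of `s` words of `w` bits each. -/
abbrev Mem (w s : ℕ) := Fin s → Word w

/-- Instructions of a word RAM with `s` memory words of `w` bits and program labels in `Λ`.
The machine has two read-only input ports. Every instruction takes one time step. -/
inductive Instr (w s : ℕ) (Λ : Type) : Type
  /-- `mem[dst] := g (mem[a], mem[b])`, where `g` is a basic operation on words (arithmetic, bitwise,
  constants, copying) or the access to a table embedded in the program at the position given by the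
  two words. Such a table is the advice of a non-uniform algorithm. -/
  | op (g : Word w → Word w → Word w) (dst a b : Fin s) (next : Λ)
  /-- `mem[dst] := mem[mem[ptr]]` -/
  | load (dst ptr : Fin s) (next : Λ)
  /-- `mem[mem[ptr]] := mem[src]` -/
  | store (ptr src : Fin s) (next : Λ)
  /-- `mem[dst] :=` the symbol at position `mem[ptr]` of the read-only input at the given port -/
  | read (port : Fin 2) (dst ptr : Fin s) (next : Λ)
  /-- Jump to the label `next (mem[a])`; conditional jumps are a special case. -/
  | branch (a : Fin s) (next : Word w → Λ)
  /-- Stop and return `mem[a]`. -/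
  | halt (a : Fin s)

/-- A program: finitely many labelled instructions. The program counter fits into one word. Words
will have logarithmically many bits, so that the length of a program and its tables are polynomial. -/
structure Program (w s : ℕ) where
  Λ : Type
  [fin : Fintype Λ]
  card_le : Fintype.card Λ ≤ 2 ^ w
  start : Λ
  code : Λ → Instr w s Λ

/-- The effect of one instruction: the next label and the new memory, or the returned word.
Loads from outside the memory give `0`, stores to the outside have no effect. -/
def Instr.exec {w s : ℕ} {Λ : Type} (inp : Fin 2 → ℕ → ℕ) (μ : Mem w s) :
    Instr w s Λ → (Λ × Mem w s) ⊕ Word w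
  | .op g dst a b next => .inl (next, Function.update μ dst (g (μ a) (μ b)))
  | .load dst ptr next =>
      .inl (next, Function.update μ dst (if h : (μ ptr : ℕ) < s then μ ⟨μ ptr, h⟩ else 0))
  | .store ptr src next =>
      .inl (next, if h : (μ ptr : ℕ) < s then Function.update μ ⟨μ ptr, h⟩ (μ src) else μ)
  | .read port dst ptr next =>
      .inl (next, Function.update μ dst (Fin.ofNat (2 ^ w) (inp port (μ ptr))))
  | .branch a next => .inl (next (μ a), μ)
  | .halt a => .inr (μ a)

/-- `P.RunsFrom inp l μ t o ν`: started at label `l` with memory `μ` and read-only inputs `inp`, the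
program stops after exactly `t` steps, returns the word `o` and leaves the memory `ν` behind. -/
inductive Program.RunsFrom {w s : ℕ} (P : Program w s) (inp : Fin 2 → ℕ → ℕ) :
    P.Λ → Mem w s → ℕ → Word w → Mem w s → Prop
  | halt {l : P.Λ} {μ : Mem w s} {o : Word w} (h : (P.code l).exec inp μ = .inr o) :
      RunsFrom P inp l μ 1 o μ
  | step {l l' : P.Λ} {μ μ' ν : Mem w s} {t : ℕ} {o : Word w}
      (h : (P.code l).exec inp μ = .inl (l', μ')) (hr : RunsFrom P inp l' μ' t o ν) :
      RunsFrom P inp l μ (t + 1) o ν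

/-- A complete run of a program, from its start label. -/
def Program.Runs {w s : ℕ} (P : Program w s) (inp : Fin 2 → ℕ → ℕ)
    (μ : Mem w s) (t : ℕ) (o : Word w) (ν : Mem w s) : Prop :=
  P.RunsFrom inp P.start μ t o ν

/-- `P.Serves F good μ is ts`: with read-only access to `F` at port `0`, the program `P` answers the
queries `is` one after the other. The first one finds the memory `μ`, every later one finds the
memory that its predecessor left behind; the argument of a query is read at port `1`. The answer `o`
to a query `i` satisfies `good i o`, and `ts` lists the numbers of steps spent on the queries. -/
inductive Program.Serves {w s : ℕ} (P : Program w s) (F : ℕ → ℕ) (good : ℕ → ℕ → Prop) :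
    Mem w s → List ℕ → List ℕ → Prop
  | nil (μ : Mem w s) : Serves P F good μ [] []
  | cons {μ ν : Mem w s} {i t : ℕ} {o : Word w} {is ts : List ℕ}
      (hr : P.Runs ![F, fun _ => i] μ t o ν) (hg : good i o)
      (hs : Serves P F good ν is ts) : Serves P F good μ (i :: is) (t :: ts)

/-! ### Random access data structures -/

/-- `Factors R a b u`: the string `u` is a concatenation, in some order, of at most `a` symbols and at
most `b` (possibly empty) substrings of `R`. -/
inductive Factors {α : Type} (R : List α) : ℕ → ℕ → List α → Prop
  | nil (a b : ℕ) : Factors R a b []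
  | symbol {a b : ℕ} {u : List α} (x : α) (h : Factors R a b u) : Factors R (a + 1) b (x :: u)
  | substring {a b : ℕ} {u : List α} (v : List α) (hv : v <:+: R) (h : Factors R a b u) :
      Factors R a (b + 1) (v ++ u)

/-- A string over the alphabet `{0, …, σ - 1}` as a read-only input (positions start at `0`). -/
def asInput {σ : ℕ} (S : List (Fin σ)) (i : ℕ) : ℕ :=
  if h : i < S.length then (S[i] : ℕ) else 0

/-- The algorithms of an offline random access data structure for references of one fixed length,
with `s` words of `w` bits. `prep R` is the memory after the preprocessing of `R`, whose running time
is not restricted; `build n` completes the construction for a text of length `n`; `query n` answers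
random access queries to a text of length `n`. -/
structure RAStructure (σ w s : ℕ) where
  prep : List (Fin σ) → Mem w s
  build : ℕ → Program w s
  query : ℕ → Program w s

/-- `D` is an offline `k`-error random access data structure for references of length `m` and texts
of length at most `L`, with construction time `tc` and amortized query time `tq`.
The construction reads `R` at port `0` and `T` at port `1` and returns the support-length `h`; the
queries read `R` but not `T`. With positions starting at `0`, the supported positions of `T` are the
`i` with `n - h ≤ i < n`, and `T.drop (n - h - 1)` is the suffix of length `h + 1`. -/
def RAStructure.Correct {σ w s : ℕ} (D : RAStructure σ w s) (k m : ℕ) (L : ℝ) (tc tq : ℕ) : Prop :=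
  ∀ R T : List (Fin σ), R.length = m → (T.length : ℝ) ≤ L →
    ∃ (t : ℕ) (h : Word w) (μ : Mem w s),
      (D.build T.length).Runs ![asInput R, asInput T] (D.prep R) t h μ ∧
      (h : ℕ) ≤ T.length ∧
      ((h : ℕ) < T.length → ¬ Factors R k (k + 1) (T.drop (T.length - h - 1))) ∧
      ∀ is : List ℕ, (∀ i ∈ is, T.length - h ≤ i ∧ i < T.length) →
        ∃ ts : List ℕ,
          (D.query T.length).Serves (asInput R) (fun i o => o = asInput T i) μ is ts ∧
          t + ts.sum ≤ tc + is.length * tq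

/-! ### Function inversion -/

/-- A function `f : [N] → [N]` as a read-only input. -/
def asOracle {N : ℕ} (f : Fin N → Fin N) (i : ℕ) : ℕ :=
  if h : i < N then (f ⟨i, h⟩ : ℕ) else 0

/-- The answer `o` inverts `f` at `y`: either `o = x + 1` for some `x` with `f x = y`, or `o = 0` and
`y` is not in the image of `f`. -/
def IsInversion {N : ℕ} (f : Fin N → Fin N) (y o : ℕ) : Prop :=
  (∃ x : Fin N, o = x + 1 ∧ (f x : ℕ) = y) ∨ (o = 0 ∧ ∀ x : Fin N, (f x : ℕ) ≠ y)

/-- The program `P` is the query algorithm of a function inversion data structure for all functions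
`[N] → [N]` with query time `t`: for every `f` there is a memory content `μ` from which `P`, with
constant-time access to `f`, answers every sequence of queries, each in at most `t` steps. -/
def Program.Inverts {w s : ℕ} (P : Program w s) (N t : ℕ) : Prop :=
  ∀ f : Fin N → Fin N, ∃ μ : Mem w s, ∀ ys : List ℕ, (∀ y ∈ ys, y < N) →
    ∃ ts : List ℕ, P.Serves (asOracle f) (IsInversion f) μ ys ts ∧ ∀ u ∈ ts, u ≤ t

/-! ### Asymptotics -/

/-- `g = Õ(f)`: bounded by `f` up to a constant and a power of the logarithm. -/
def IsSoftO (g f : ℕ → ℝ) : Prop :=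
  ∃ c : ℕ, g =O[atTop] fun n => f n * Real.log n ^ c

/-- The number of bits of `s` memory words and the program counter, with words of `w` bits. -/
def spaceBits (w s : ℕ) : ℕ := (s + 1) * w

/-! Take `N` strings of `n ≈ m^χ log m` bits and let the reference be `S (f 0) S (f 1) …`. To invert
`f` at `y`, run the construction on the text `S y` and then query all its positions, simulating each
read of the reference by one evaluation of `f` and one table lookup. If a read falls into a block
`x` with `f x = y`, then `x` is the answer. If `y` has a preimage, the text is a substring of the
reference, so a support-length `h < n` certifies that there is none. If `h = n` and no query touches
a block of `y`, then the queries recover the `n` bits of `S y` from the other strings and a memory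
of `O(m^χ)` bits, far fewer than `n`; a good choice of `S` excludes this.

Such a choice exists by counting. For fixed `f`, fewer than a fraction `1/N` of all collections are
bad (`card_decodable_mul_le`, `mul_card_not_incompressible_lt`). One collection need not serve all
`N^N` functions, but the families of `N` collections that are all bad for a given `f` have a
fraction below `N^(-N)`. Hence some family, embedded in the program, contains a good collection for
every `f` (`exists_incompressible_family`), and its index is stored in one word.

The simulation is `simulate_run` and `solves_start`. Construction and `n` queries cost `Õ(m^(χ+δ))`.
The blocks fit if `N n ≤ m`, that is, `N ≈ m^(1-χ)` up to logarithms, which divides the exponents by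
`1 - χ`. -/

/-! ### Runs of programs -/

theorem Program.RunsFrom.unique {w s : ℕ} {P : Program w s} {inp : Fin 2 → ℕ → ℕ} {l : P.Λ}
    {μ ν ν' : Mem w s} {t t' : ℕ} {o o' : Word w} (h : P.RunsFrom inp l μ t o ν)
    (h' : P.RunsFrom inp l μ t' o' ν') : t = t' ∧ o = o' ∧ ν = ν' := by
  induction h generalizing t' with
  | halt h =>
    cases h' with
    | halt h2 => rw [h] at h2; simp_all
    | step h2 _ => rw [h] at h2; simp at h2
  | step h _ ih =>
    cases h' with
    | halt h2 => rw [h] at h2; simp at h2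
    | step h2 h3 =>
      rw [h] at h2
      simp only [Sum.inl.injEq, Prod.mk.injEq] at h2
      obtain ⟨rfl, rfl⟩ := h2
      obtain ⟨rfl, rfl, rfl⟩ := ih h3
      simp

theorem Program.RunsFrom.pos {w s : ℕ} {P : Program w s} {inp : Fin 2 → ℕ → ℕ} {l : P.Λ}
    {μ ν : Mem w s} {t : ℕ} {o : Word w} (h : P.RunsFrom inp l μ t o ν) : 0 < t := by
  cases h <;> omega

/-- By determinism the two sequences of runs coincide, so each answer meets both specifications.
With two candidate strings as specifications, this shows that a memory content decodes to at most
one string. -/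
theorem Program.Serves.exists_common {w s : ℕ} {P : Program w s} {F : ℕ → ℕ}
    {good good' : ℕ → ℕ → Prop} {μ : Mem w s} {is ts ts' : List ℕ}
    (h : P.Serves F good μ is ts) (h' : P.Serves F good' μ is ts') :
    ∀ i ∈ is, ∃ o : ℕ, good i o ∧ good' i o := by
  induction h generalizing ts' with
  | nil => simp
  | cons hr hg _ ih =>
    cases h' with
    | cons hr' hg' hs' =>
      obtain ⟨rfl, rfl, rfl⟩ := hr.unique hr'
      intro i hi
      rcases List.mem_cons.1 hi with rfl | hi
      · exact ⟨_, hg, hg'⟩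
      · exact ih hs' i hi

/-- Started at label `l` with memory `μ`, the program stops within `T` steps, and its answer and
final memory satisfy `post`. -/
def Program.EndsWithin {w s : ℕ} (P : Program w s) (inp : Fin 2 → ℕ → ℕ)
    (post : Word w → Mem w s → Prop) (T : ℕ) (l : P.Λ) (μ : Mem w s) : Prop :=
  ∃ t ≤ T, ∃ o ν, P.RunsFrom inp l μ t o ν ∧ post o ν

section EndsWithin

variable {w s : ℕ} {P : Program w s} {inp : Fin 2 → ℕ → ℕ} {post : Word w → Mem w s → Prop}

theorem Program.EndsWithin.mono {T T' : ℕ} {l : P.Λ} {μ : Mem w s}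
    (h : P.EndsWithin inp post T l μ) (hT : T ≤ T') : P.EndsWithin inp post T' l μ :=
  let ⟨t, ht, r⟩ := h
  ⟨t, ht.trans hT, r⟩

theorem Program.EndsWithin.step {T : ℕ} {l l' : P.Λ} {μ μ' : Mem w s}
    (he : (P.code l).exec inp μ = .inl (l', μ')) (h : P.EndsWithin inp post T l' μ') :
    P.EndsWithin inp post (T + 1) l μ :=
  let ⟨t, ht, o, ν, hr, hp⟩ := h
  ⟨t + 1, by omega, o, ν, .step he hr, hp⟩

theorem Program.EndsWithin.halt {l : P.Λ} {μ : Mem w s} {o : Word w}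
    (he : (P.code l).exec inp μ = .inr o) (h : post o μ) : P.EndsWithin inp post 1 l μ :=
  ⟨1, le_rfl, o, μ, .halt he, h⟩

end EndsWithin

/-! ### References made of blocks -/

/-- The `j`-th bit of the `u`-th string of a collection, `0` outside. -/
def blockBit {N n : ℕ} (S : Fin N → Fin n → Bool) (u j : ℕ) : ℕ :=
  if h : u < N ∧ j < n then (S ⟨u, h.1⟩ ⟨j, h.2⟩).toNat else 0

/-- The concatenation of the strings `S (f 0), S (f 1), …`, padded by zeros. -/
def blockRef {N n : ℕ} (f : Fin N → Fin N) (S : Fin N → Fin n → Bool) (j : ℕ) : ℕ :=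
  if j < N * n then blockBit S (asOracle f (j / n)) (j % n) else 0

theorem blockBit_lt_two {N n : ℕ} (S : Fin N → Fin n → Bool) (u j : ℕ) : blockBit S u j < 2 := by
  unfold blockBit
  split_ifs
  · exact Bool.toNat_lt _
  · omega

theorem blockRef_lt_two {N n : ℕ} (f : Fin N → Fin N) (S : Fin N → Fin n → Bool) (j : ℕ) :
    blockRef f S j < 2 := by
  unfold blockRef
  split_ifs
  · exact blockBit_lt_two _ _ _
  · omega

theorem blockBit_update {N n : ℕ} (S : Fin N → Fin n → Bool) (y : Fin N) (v : Fin n → Bool)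
    {u : ℕ} (j : ℕ) (hu : u ≠ y) : blockBit (Function.update S y v) u j = blockBit S u j := by
  unfold blockBit
  split_ifs with h
  · rw [Function.update_of_ne]
    simpa [Fin.ext_iff] using hu
  · rfl

theorem asOracle_lt {N : ℕ} (f : Fin N → Fin N) {x : ℕ} (hx : x < N) : asOracle f x < N := by
  simp [asOracle, hx]

/-- The string of length `m` with the symbols `u 0, u 1, …`. -/
def stringOf {σ : ℕ} (m : ℕ) (u : ℕ → ℕ) (hu : ∀ j, u j < σ) : List (Fin σ) :=
  List.ofFn fun j : Fin m => ⟨u j, hu j⟩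

theorem length_stringOf {σ m : ℕ} {u : ℕ → ℕ} {hu : ∀ j, u j < σ} :
    (stringOf m u hu).length = m := by
  simp [stringOf]

theorem asInput_stringOf {σ m : ℕ} {u : ℕ → ℕ} {hu : ∀ j, u j < σ} (h0 : ∀ j, m ≤ j → u j = 0) :
    asInput (stringOf m u hu) = u := by
  funext j
  unfold asInput
  split_ifs with h
  · simp [stringOf]
  · rw [length_stringOf] at h
    exact (h0 j (by omega)).symm

theorem stringOf_infix {σ m n d : ℕ} {u v : ℕ → ℕ} {hu : ∀ j, u j < σ} {hv : ∀ j, v j < σ}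
    (hd : d + n ≤ m) (h : ∀ j < n, v j = u (d + j)) : stringOf n v hv <:+: stringOf m u hu := by
  have : stringOf n v hv = ((stringOf m u hu).drop d).take n := by
    apply List.ext_getElem
    · simp [length_stringOf]; omega
    · intro j h1 h2
      rw [length_stringOf] at h1
      simp [stringOf, h j h1]
  rw [this]
  exact (List.take_prefix _ _).isInfix.trans (List.drop_suffix _ _).isInfix

/-- A single substring suffices, so the reduction never uses the `k` errors. -/
theorem Factors.of_infix {α : Type} {R v : List α} (h : v <:+: R) (k : ℕ) :
    Factors R k (k + 1) v := by
  simpa using Factors.substring v h (Factors.nil k k)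

theorem blockRef_mul_add {N n : ℕ} (f : Fin N → Fin N) (S : Fin N → Fin n → Bool) (x : Fin N)
    {j : ℕ} (hj : j < n) : blockRef f S (x * n + j) = blockBit S (f x) j := by
  have h1 : (x * n + j) / n = x := by
    rw [mul_comm, Nat.mul_add_div (by omega), Nat.div_eq_of_lt hj, add_zero]
  have h2 : (x * n + j) % n = j := by
    rw [mul_comm, Nat.mul_add_mod, Nat.mod_eq_of_lt hj]
  have h3 : x * n + j < N * n := by
    calc x * n + j < x * n + n := by omega
      _ = (x + 1) * n := by ring
      _ ≤ N * n := Nat.mul_le_mul_right _ x.2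
  simp [blockRef, h1, h2, h3, asOracle]

/-! ### Incompressible collections of strings -/

/-- From the memory content `μ` and the input `F`, the program `Q` answers the queries
`0, …, n - 1` by the bits of the `y`-th string of `S`. -/
def Decodes {w s N n : ℕ} (Q : Program w s) (F : ℕ → ℕ) (S : Fin N → Fin n → Bool) (y : Fin N)
    (μ : Mem w s) : Prop :=
  ∃ ts, Q.Serves F (fun i o => o = blockBit S y i) μ (List.range n) ts

theorem Decodes.unique {w s N n : ℕ} {Q : Program w s} {F : ℕ → ℕ} {S S' : Fin N → Fin n → Bool}
    {y : Fin N} {μ : Mem w s} (h : Decodes Q F S y μ) (h' : Decodes Q F S' y μ) : S y = S' y := by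
  obtain ⟨_, h⟩ := h
  obtain ⟨_, h'⟩ := h'
  funext j
  obtain ⟨o, h1, h2⟩ := h.exists_common h' j (by simp)
  rw [h1] at h2
  simp only [blockBit, Fin.is_lt, and_self, dite_true, Fin.eta] at h2
  revert h2
  cases S y j <;> cases S' y j <;> simp

/-- No string of the collection can be decoded from a memory content with access to the blocks of
the other strings only. -/
def Incompressible {w s N n : ℕ} (Q : Program w s) (f : Fin N → Fin N)
    (S : Fin N → Fin n → Bool) : Prop :=
  ∀ y μ, ¬ Decodes Q (blockRef f (Function.update S y fun _ => false)) S y μ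

open Classical in
-- Encode a decodable `S` and an arbitrary string `v` by a decoding memory content and the
-- collection with `S y` replaced by `v`. Nothing is lost: `v` is visible, and the memory together
-- with the other strings determines `S y`.
theorem card_decodable_mul_le {w s N n : ℕ} (Q : Program w s) (f : Fin N → Fin N) (y : Fin N) :
    Fintype.card {S : Fin N → Fin n → Bool //
      ∃ μ, Decodes Q (blockRef f (Function.update S y fun _ => false)) S y μ} * 2 ^ n ≤
      2 ^ (w * s) * Fintype.card (Fin N → Fin n → Bool) := by
  have h1 : 2 ^ n = Fintype.card (Fin n → Bool) := by simp
  have h2 : 2 ^ (w * s) = Fintype.card (Mem w s) := by simp [Mem, Word, pow_mul]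
  rw [h1, h2, ← Fintype.card_prod, ← Fintype.card_prod]
  refine Fintype.card_le_of_injective
    (fun p => (p.1.2.choose, Function.update p.1.1 y p.2)) ?_
  rintro ⟨⟨S, hS⟩, v⟩ ⟨⟨S', hS'⟩, v'⟩ h
  simp only [Prod.mk.injEq] at h
  obtain ⟨hμ, hu⟩ := h
  have hv : v = v' := by simpa using congrFun hu y
  have hz : Function.update S y (fun _ => false) = Function.update S' y fun _ => false := by
    have := congrArg (fun g => Function.update g y fun _ => false) hu
    simpa using this
  have e1 := hS.choose_spec
  have e2 := hS'.choose_spec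
  rw [hμ, hz] at e1
  have hy : S y = S' y := e1.unique e2
  have : S = S' := by
    funext z
    by_cases hz' : z = y
    · rw [hz', hy]
    · simpa [hz'] using congrFun hz z
  subst this hv
  rfl

open Classical in
-- Union bound over `y`; the second factor `N` in the hypothesis leaves a bad fraction below `1/N`.
theorem mul_card_not_incompressible_lt {w s N n : ℕ}
    (h : N * N * 2 ^ (w * s) < 2 ^ n) (Q : Program w s) (f : Fin N → Fin N) :
    N * (Finset.univ.filter fun S : Fin N → Fin n → Bool => ¬ Incompressible Q f S).card <
      Fintype.card (Fin N → Fin n → Bool) := by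
  set K := Fintype.card (Fin N → Fin n → Bool) with hK
  have hK0 : 0 < K := Fintype.card_pos
  have hsub : (Finset.univ.filter fun S : Fin N → Fin n → Bool => ¬ Incompressible Q f S) ⊆
      Finset.univ.biUnion fun y : Fin N => Finset.univ.filter fun S : Fin N → Fin n → Bool =>
        ∃ μ, Decodes Q (blockRef f (Function.update S y fun _ => false)) S y μ := by
    intro S hS
    simpa [Incompressible] using hS
  have hle := (Finset.card_le_card hsub).trans Finset.card_biUnion_le
  have hsum : (Finset.univ.filter fun S : Fin N → Fin n → Bool =>
      ¬ Incompressible Q f S).card * 2 ^ n ≤ N * (2 ^ (w * s) * K) := by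
    calc _ ≤ (∑ y : Fin N, (Finset.univ.filter fun S : Fin N → Fin n → Bool =>
        ∃ μ, Decodes Q (blockRef f (Function.update S y fun _ => false)) S y μ).card) * 2 ^ n :=
          Nat.mul_le_mul_right _ hle
      _ ≤ ∑ _y : Fin N, 2 ^ (w * s) * K := by
          rw [Finset.sum_mul]
          refine Finset.sum_le_sum fun y _ => ?_
          rw [← Fintype.card_subtype]
          exact card_decodable_mul_le Q f y
      _ = _ := by simp
  refine lt_of_mul_lt_mul_right (a := 2 ^ n) ?_ (Nat.zero_le _)
  calc _ ≤ N * (N * (2 ^ (w * s) * K)) := by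
        rw [mul_assoc]; exact Nat.mul_le_mul_left _ hsum
    _ = N * N * 2 ^ (w * s) * K := by ring
    _ < 2 ^ n * K := Nat.mul_lt_mul_of_pos_right h hK0
    _ = K * 2 ^ n := mul_comm _ _

/-- A family of `N` collections contains an incompressible one for every function. -/
theorem exists_incompressible_family {w s N n : ℕ} (hN : 0 < N)
    (h : N * N * 2 ^ (w * s) < 2 ^ n) (Q : Program w s) :
    ∃ S : Fin N → Fin N → Fin n → Bool, ∀ f : Fin N → Fin N, ∃ i, Incompressible Q f (S i) := by
  classical
  by_contra hcon
  push Not at hcon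
  set B : (Fin N → Fin N) → Finset (Fin N → Fin n → Bool) := fun f =>
    Finset.univ.filter fun S => ¬ Incompressible Q f S with hB
  have hlt : ∀ f, N * (B f).card < Fintype.card (Fin N → Fin n → Bool) := fun f =>
    mul_card_not_incompressible_lt h Q f
  set K := Fintype.card (Fin N → Fin n → Bool) with hK
  -- If no family works, each one consists, for some `f`, of `N` collections that are bad for `f`.
  have hsub : (Finset.univ : Finset (Fin N → Fin N → Fin n → Bool)) ⊆
      Finset.univ.biUnion fun f => Fintype.piFinset fun _ : Fin N => B f := by
    intro S _
    obtain ⟨f, hf⟩ := hcon S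
    simp only [Finset.mem_biUnion, Finset.mem_univ, true_and, Fintype.mem_piFinset]
    exact ⟨f, fun i => by simp [hB, hf i]⟩
  have hle : K ^ N ≤ ∑ f : Fin N → Fin N, (B f).card ^ N := by
    have := (Finset.card_le_card hsub).trans Finset.card_biUnion_le
    simp only [Fintype.card_piFinset_const, Finset.card_univ] at this
    refine le_trans (le_of_eq ?_) this
    rw [Fintype.card_fun (α := Fin N), Fintype.card_fin]
  have : Nonempty (Fin N → Fin N) := ⟨id⟩
  -- The factor `N ^ N` on the left cancels against the number of functions on the right.
  have hs : ∑ f : Fin N → Fin N, (N * (B f).card) ^ N < ∑ _f : Fin N → Fin N, K ^ N :=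
    Finset.sum_lt_sum_of_nonempty Finset.univ_nonempty fun f _ =>
      Nat.pow_lt_pow_left (hlt f) hN.ne'
  simp only [mul_pow, ← Finset.mul_sum, Finset.sum_const, Finset.card_univ, Fintype.card_fun,
    Fintype.card_fin, smul_eq_mul] at hs
  exact absurd hs (not_lt.2 (Nat.mul_le_mul_left _ hle))

/-! ### The simulating program -/

/-- Change of the word size. -/
def Word.cast {w : ℕ} (W : ℕ) (v : Word w) : Word W := Fin.ofNat (2 ^ W) v

theorem Word.val_ofNat_of_lt {W v : ℕ} (h : v < 2 ^ W) : ((Fin.ofNat (2 ^ W) v : Word W) : ℕ) = v := by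
  simp [Fin.ofNat, Nat.mod_eq_of_lt h]

theorem Word.cast_cast {w W : ℕ} (h : w ≤ W) (v : Word w) : (v.cast W).cast w = v := by
  have h1 : (v : ℕ) < 2 ^ W := v.2.trans_le (Nat.pow_le_pow_right (by norm_num) h)
  apply Fin.ext
  unfold Word.cast
  rw [Word.val_ofNat_of_lt h1, Word.val_ofNat_of_lt v.2]

/-- The memory of the simulating program: the simulated memory, a saved copy of its initial content,
one cell for intermediate results and one for the choice of a collection of strings. -/
def memCell {s : ℕ} (c : Fin s ⊕ Fin s ⊕ Fin 2) : Fin (s + (s + 2)) :=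
  finSumFinEquiv (c.map id finSumFinEquiv)

theorem memCell_injective {s : ℕ} : Function.Injective (memCell (s := s)) :=
  finSumFinEquiv.injective.comp (Sum.map_injective.2 ⟨Function.injective_id, Equiv.injective _⟩)

/-- The cells of the simulated memory. -/
def workCell {s : ℕ} (i : Fin s) : Fin (s + (s + 2)) := memCell (.inl i)
/-- The cells of the saved copy. -/
def savedCell {s : ℕ} (i : Fin s) : Fin (s + (s + 2)) := memCell (.inr (.inl i))
/-- The cell for intermediate results. -/
def tmpCell {s : ℕ} : Fin (s + (s + 2)) := memCell (.inr (.inr 0))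
/-- The cell for the choice of a collection. -/
def seedCell {s : ℕ} : Fin (s + (s + 2)) := memCell (.inr (.inr 1))

@[simp] theorem workCell_inj {s : ℕ} {i j : Fin s} : workCell i = workCell j ↔ i = j := by
  simp [workCell, memCell_injective.eq_iff]
@[simp] theorem workCell_ne_tmpCell {s : ℕ} {i : Fin s} : workCell i ≠ tmpCell := by
  simp [workCell, tmpCell, memCell_injective.eq_iff]
@[simp] theorem savedCell_ne_workCell {s : ℕ} {i j : Fin s} : savedCell i ≠ workCell j := by
  simp [workCell, savedCell, memCell_injective.eq_iff]
@[simp] theorem savedCell_ne_tmpCell {s : ℕ} {i : Fin s} : savedCell i ≠ tmpCell := by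
  simp [tmpCell, savedCell, memCell_injective.eq_iff]
@[simp] theorem seedCell_ne_workCell {s : ℕ} {j : Fin s} : seedCell ≠ workCell j := by
  simp [workCell, seedCell, memCell_injective.eq_iff]
@[simp] theorem seedCell_ne_tmpCell {s : ℕ} : (seedCell : Fin (s + (s + 2))) ≠ tmpCell := by
  simp [tmpCell, seedCell, memCell_injective.eq_iff]

/-- The algorithms of a random access data structure for texts of length `n`, and `N` collections of
`N` strings of length `n` each. -/
structure InversionData (w s N n : ℕ) where
  build : Program w s
  query : Program w s
  strings : Fin N → Fin N → Fin n → Bool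

namespace InversionData

variable {w s N n : ℕ} (A : InversionData w s N n)

/-- The program of a phase: `none` is the construction, `some i` is the query for position `i`. -/
def prog : Option (Fin n) → Program w s
  | none => A.build
  | some _ => A.query

/-- The second input in a phase. -/
def port (i y : Fin N) : Option (Fin n) → ℕ → ℕ
  | none => blockBit (A.strings i) y
  | some q => fun _ => q

/-- The labels of the simulating program, which carry the choice `i` of a collection, the element
`y` to be inverted, the phase `p` and the simulated label `l`. -/
inductive Label : Type
  | start
  | arg
  | seed (y : Fin N)
  | copy (i y : Fin N) (j : Fin (s + 1))
  | main (i y : Fin N) (p : Option (Fin n)) (l : (A.prog p).Λ)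
  | addr (i y : Fin N) (p : Option (Fin n)) (l : (A.prog p).Λ) (v : Word w)
  | fetch (i y : Fin N) (p : Option (Fin n)) (l : (A.prog p).Λ) (v : Word w)
  | test (i y : Fin N) (p : Option (Fin n)) (l : (A.prog p).Λ) (v : Word w)
  | put (i y : Fin N) (p : Option (Fin n)) (l : (A.prog p).Λ) (v : Word w)
  | found (x : Fin N)
  | fail
  | answer

/-- The label that continues with the query for position `q`. -/
def enter (i y : Fin N) (q : ℕ) : A.Label :=
  if h : q < n then .main i y (some ⟨q, h⟩) (A.prog (some ⟨q, h⟩)).start else .fail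

/-- The label after a phase that returned the word `o`. -/
def follow (i y : Fin N) (p : Option (Fin n)) (o : Word w) : A.Label :=
  match p with
  | none => if (o : ℕ) = n then A.enter i y 0 else .fail
  | some q => A.enter i y (q + 1)

/-- The instructions of the simulating program. -/
def code (W : ℕ) : A.Label → Instr W (s + (s + 2)) A.Label
  | .start => .read 1 tmpCell tmpCell .arg
  | .arg => .branch tmpCell fun v => if h : (v : ℕ) < N then .seed ⟨v, h⟩ else .fail
  | .seed y => .branch seedCell fun v => if h : (v : ℕ) < N then .copy ⟨v, h⟩ y 0 else .fail
  | .copy i y j =>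
      if h : (j : ℕ) < s then
        .op (fun a _ => a) (workCell ⟨j, h⟩) (savedCell ⟨j, h⟩) tmpCell
          (.copy i y ⟨j + 1, by omega⟩)
      else .branch tmpCell fun _ => .main i y none (A.prog none).start
  | .main i y p l =>
      match (A.prog p).code l with
      | .op g dst a b next =>
          .op (fun u v => (g (u.cast w) (v.cast w)).cast W) (workCell dst) (workCell a) (workCell b)
            (.main i y p next)
      | .load _ ptr _ => .branch (workCell ptr) fun v => .addr i y p l (v.cast w)
      | .store ptr _ _ => .branch (workCell ptr) fun v => .addr i y p l (v.cast w)
      | .read _ _ ptr _ => .branch (workCell ptr) fun v => .addr i y p l (v.cast w)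
      | .branch a next => .branch (workCell a) fun v => .main i y p (next (v.cast w))
      | .halt a => .branch (workCell a) fun v => A.follow i y p (v.cast w)
  | .addr i y p l v =>
      match (A.prog p).code l with
      | .load dst _ next =>
          if h : (v : ℕ) < s then
            .op (fun u _ => u) (workCell dst) (workCell ⟨v, h⟩) tmpCell (.main i y p next)
          else .op (fun _ _ => Word.cast W (0 : Word w)) (workCell dst) tmpCell tmpCell
            (.main i y p next)
      | .store _ src next =>
          if h : (v : ℕ) < s then
            .op (fun u _ => u) (workCell ⟨v, h⟩) (workCell src) tmpCell (.main i y p next)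
          else .branch tmpCell fun _ => .main i y p next
      | .read b dst _ next =>
          -- Only genuine positions of the blocks need an evaluation of `f`. The padding is zero,
          -- and the second port (the text or the query position) is known from the label and the
          -- embedded table.
          if b = 0 ∧ (v : ℕ) < N * n then
            .op (fun _ _ => Fin.ofNat (2 ^ W) (v / n)) tmpCell tmpCell tmpCell (.fetch i y p l v)
          else
            .op (fun _ _ => Word.cast W (Fin.ofNat (2 ^ w) (if b = 0 then 0 else A.port i y p v) : Word w))
              (workCell dst) tmpCell tmpCell (.main i y p next)
      -- Never reached: only loads, stores and reads lead to this kind of label.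
      | _ => .halt tmpCell
  | .fetch i y p l v => .read 0 tmpCell tmpCell (.test i y p l v)
  | .test i y p l v =>
      .branch tmpCell fun u =>
        if (u : ℕ) = y then if h : (v : ℕ) / n < N then .found ⟨v / n, h⟩ else .fail
        else .put i y p l (Fin.ofNat (2 ^ w) (blockBit (A.strings i) u (v % n)))
  | .put i y p l u =>
      match (A.prog p).code l with
      | .read _ dst _ next =>
          .op (fun _ _ => u.cast W) (workCell dst) tmpCell tmpCell (.main i y p next)
      | _ => .halt tmpCell
  | .found x => .op (fun _ _ => Fin.ofNat (2 ^ W) (x + 1)) tmpCell tmpCell tmpCell .answer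
  | .fail => .op (fun _ _ => Fin.ofNat (2 ^ W) 0) tmpCell tmpCell tmpCell .answer
  | .answer => .halt tmpCell

/-! ### Counting the labels -/

/-- The number of a simulated label. -/
noncomputable def labelNum (p : Option (Fin n)) (l : (A.prog p).Λ) : ℕ :=
  letI := (A.prog p).fin
  Fintype.equivFin _ l

theorem labelNum_lt (p : Option (Fin n)) (l : (A.prog p).Λ) : A.labelNum p l < 2 ^ w := by
  let := (A.prog p).fin
  exact (Fintype.equivFin _ l).2.trans_le (A.prog p).card_le

theorem labelNum_inj {p : Option (Fin n)} {l l' : (A.prog p).Λ}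
    (h : A.labelNum p l = A.labelNum p l') : l = l' := by
  let := (A.prog p).fin
  exact (Fintype.equivFin _).injective (Fin.ext h)

/-- The number of a phase. -/
def phaseNum : Option (Fin n) → ℕ
  | none => n
  | some q => q

theorem phaseNum_le (p : Option (Fin n)) : phaseNum p ≤ n := by
  cases p <;> simp [phaseNum]

theorem phaseNum_inj {p p' : Option (Fin n)} (h : phaseNum p = phaseNum p') : p = p' := by
  cases p <;> cases p' <;> simp [phaseNum, Fin.ext_iff] at h ⊢ <;> omega

/-- The coordinates of a label. -/
noncomputable def labelCode : A.Label → Fin 12 × ℕ × ℕ × ℕ × ℕ × ℕ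
  | .start => (0, 0, 0, 0, 0, 0)
  | .arg => (1, 0, 0, 0, 0, 0)
  | .seed y => (2, 0, y, 0, 0, 0)
  | .copy i y j => (3, i, y, j, 0, 0)
  | .main i y p l => (4, i, y, phaseNum p, A.labelNum p l, 0)
  | .addr i y p l v => (5, i, y, phaseNum p, A.labelNum p l, v)
  | .fetch i y p l v => (6, i, y, phaseNum p, A.labelNum p l, v)
  | .test i y p l v => (7, i, y, phaseNum p, A.labelNum p l, v)
  | .put i y p l v => (8, i, y, phaseNum p, A.labelNum p l, v)
  | .found x => (9, x, 0, 0, 0, 0)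
  | .fail => (10, 0, 0, 0, 0, 0)
  | .answer => (11, 0, 0, 0, 0, 0)

theorem labelCode_injective : Function.Injective A.labelCode := by
  intro a b h
  cases a <;> cases b <;> simp only [labelCode, Prod.mk.injEq] at h <;>
    first
    | rfl
    | (exfalso; revert h; simp; done)
    | (simp only [Fin.val_inj, true_and, and_true] at h
       first
       | (obtain ⟨rfl, rfl, rfl⟩ := h; rfl)
       | (obtain ⟨rfl, rfl, h, h2⟩ := h
          obtain rfl := phaseNum_inj h
          first
          | (obtain ⟨h2, rfl⟩ := h2
             obtain rfl := A.labelNum_inj h2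
             rfl)
          | (obtain rfl := A.labelNum_inj h2
             rfl)))

theorem labelCode_mem {a : ℕ} (hN : N < 2 ^ a) (hn : n < 2 ^ a) (hs : s < 2 ^ a) (hw : w ≤ a)
    (l : A.Label) : A.labelCode l ∈ (Finset.univ ×ˢ Finset.range (2 ^ a) ×ˢ Finset.range (2 ^ a) ×ˢ
      Finset.range (2 ^ a) ×ˢ Finset.range (2 ^ a) ×ˢ Finset.range (2 ^ a) :
      Finset (Fin 12 × ℕ × ℕ × ℕ × ℕ × ℕ)) := by
  have hw' : 2 ^ w ≤ 2 ^ a := Nat.pow_le_pow_right (by norm_num) hw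
  have h0 : 0 < 2 ^ a := by positivity
  have hy (y : Fin N) : (y : ℕ) < 2 ^ a := y.2.trans hN
  have hj (j : Fin (s + 1)) : (j : ℕ) < 2 ^ a := by omega
  have hv (v : Word w) : (v : ℕ) < 2 ^ a := v.2.trans_le hw'
  have hp (p : Option (Fin n)) : phaseNum p < 2 ^ a := (phaseNum_le p).trans_lt hn
  have hl (p : Option (Fin n)) (l : (A.prog p).Λ) : A.labelNum p l < 2 ^ a :=
    (A.labelNum_lt p l).trans_le hw'
  cases l <;> simp [labelCode, h0, hy, hj, hv, hp, hl]

/-- Only finiteness matters here, so the coordinates are bounded crudely. -/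
noncomputable instance : Fintype A.Label := by
  classical
  exact Fintype.ofInjective
    (β := (Finset.univ ×ˢ Finset.range (2 ^ (N + n + s + w)) ×ˢ Finset.range (2 ^ (N + n + s + w)) ×ˢ
      Finset.range (2 ^ (N + n + s + w)) ×ˢ Finset.range (2 ^ (N + n + s + w)) ×ˢ
      Finset.range (2 ^ (N + n + s + w)) : Finset (Fin 12 × ℕ × ℕ × ℕ × ℕ × ℕ)))
    (fun l => ⟨A.labelCode l, A.labelCode_mem
      (Nat.lt_two_pow_self.trans_le (Nat.pow_le_pow_right (by norm_num) (by omega)))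
      (Nat.lt_two_pow_self.trans_le (Nat.pow_le_pow_right (by norm_num) (by omega)))
      (Nat.lt_two_pow_self.trans_le (Nat.pow_le_pow_right (by norm_num) (by omega))) (by omega) l⟩)
    fun _ _ h => A.labelCode_injective (congrArg Subtype.val h)

/-- Five coordinates of `a` bits each, and four bits for the twelve kinds of labels. -/
theorem card_label_le {a : ℕ} (hN : N < 2 ^ a) (hn : n < 2 ^ a) (hs : s < 2 ^ a) (hw : w ≤ a) :
    Fintype.card A.Label ≤ 2 ^ (5 * a + 4) := by
  have := Finset.card_le_card_of_injOn (s := Finset.univ) A.labelCode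
    (fun l _ => A.labelCode_mem hN hn hs hw l) A.labelCode_injective.injOn
  simp only [Finset.card_univ, Finset.card_product, Fintype.card_fin, Finset.card_range] at this
  refine this.trans ?_
  calc _ = 12 * 2 ^ (5 * a) := by ring
    _ ≤ 16 * 2 ^ (5 * a) := by omega
    _ = _ := by ring

end InversionData

/-! ### Correctness of the simulation -/

namespace InversionData

variable {w s N n : ℕ} (A : InversionData w s N n)

/-- The simulating program. -/
noncomputable def inverter (W : ℕ) (h : Fintype.card A.Label ≤ 2 ^ W) : Program W (s + (s + 2)) where
  Λ := A.Label
  card_le := h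
  start := .start
  code := A.code W

variable {W : ℕ}

/-- The memory contents between two queries: the saved copy of `μ₀` and the choice `i`. -/
structure Ready (μ₀ : Mem w s) (i : Fin N) (μ' : Mem W (s + (s + 2))) : Prop where
  saved : ∀ j, μ' (savedCell j) = (μ₀ j).cast W
  seed : μ' seedCell = Fin.ofNat (2 ^ W) i

/-- The memory contents during the simulation: additionally, the simulated memory is `μ`. -/
structure Represents (μ₀ : Mem w s) (i : Fin N) (μ : Mem w s) (μ' : Mem W (s + (s + 2))) : Prop
    extends Ready μ₀ i μ' where
  work : ∀ j, (μ' (workCell j)).cast w = μ j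

theorem Ready.update_tmp {μ₀ : Mem w s} {i : Fin N} {μ' : Mem W (s + (s + 2))}
    (h : Ready μ₀ i μ') (x : Word W) : Ready μ₀ i (Function.update μ' tmpCell x) :=
  ⟨fun j => by simp [h.saved], by simp [h.seed]⟩

theorem Ready.update_work {μ₀ : Mem w s} {i : Fin N} {μ' : Mem W (s + (s + 2))}
    (h : Ready μ₀ i μ') (d : Fin s) (x : Word W) :
    Ready μ₀ i (Function.update μ' (workCell d) x) :=
  ⟨fun j => by simp [h.saved], by simp [h.seed]⟩

theorem Represents.update_tmp {μ₀ μ : Mem w s} {i : Fin N} {μ' : Mem W (s + (s + 2))}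
    (h : Represents μ₀ i μ μ') (x : Word W) :
    Represents μ₀ i μ (Function.update μ' tmpCell x) :=
  ⟨h.toReady.update_tmp x, fun j => by simp [h.work]⟩

theorem Represents.update_work {μ₀ μ : Mem w s} {i : Fin N} {μ' : Mem W (s + (s + 2))}
    (h : Represents μ₀ i μ μ') (d : Fin s) {v : Word w} {x : Word W} (hx : x.cast w = v) :
    Represents μ₀ i (Function.update μ d v) (Function.update μ' (workCell d) x) := by
  refine ⟨h.toReady.update_work d x, fun j => ?_⟩
  by_cases hj : j = d
  · subst hj; simpa using hx
  · simp [hj, h.work]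

/-- What the simulating program achieves for `f` and `y`. -/
def Post (f : Fin N → Fin N) (μ₀ : Mem w s) (i y : Fin N) (o : Word W)
    (ν : Mem W (s + (s + 2))) : Prop :=
  IsInversion f y o ∧ Ready μ₀ i ν

section Simulation

variable {hW : Fintype.card A.Label ≤ 2 ^ W} {f : Fin N → Fin N} {μ₀ : Mem w s} {i y : Fin N}

/-- The simulating program stops within `T` steps and inverts `f` at `y`. -/
def Solves (hW : Fintype.card A.Label ≤ 2 ^ W) (f : Fin N → Fin N) (μ₀ : Mem w s) (i y : Fin N)
    (T : ℕ) (l : A.Label) (μ' : Mem W (s + (s + 2))) : Prop :=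
  (A.inverter W hW).EndsWithin ![asOracle f, fun _ => y] (Post f μ₀ i y) T l μ'

variable {A}

theorem Solves.mono {T T' : ℕ} {l : A.Label} {μ' : Mem W (s + (s + 2))}
    (h : A.Solves hW f μ₀ i y T l μ') (hT : T ≤ T') : A.Solves hW f μ₀ i y T' l μ' :=
  Program.EndsWithin.mono h hT

theorem Solves.op {T : ℕ} {l l' : A.Label} {μ' : Mem W (s + (s + 2))} {g : Word W → Word W → Word W}
    {d a b : Fin (s + (s + 2))} (hl : A.code W l = .op g d a b l')
    (h : A.Solves hW f μ₀ i y T l' (Function.update μ' d (g (μ' a) (μ' b)))) :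
    A.Solves hW f μ₀ i y (T + 1) l μ' :=
  Program.EndsWithin.step (P := A.inverter W hW)
    (show (A.code W l).exec _ _ = _ by rw [hl]; rfl) h

theorem Solves.branch {T : ℕ} {l : A.Label} {μ' : Mem W (s + (s + 2))} {a : Fin (s + (s + 2))}
    {next : Word W → A.Label} (hl : A.code W l = .branch a next)
    (h : A.Solves hW f μ₀ i y T (next (μ' a)) μ') : A.Solves hW f μ₀ i y (T + 1) l μ' :=
  Program.EndsWithin.step (P := A.inverter W hW)
    (show (A.code W l).exec _ _ = _ by rw [hl]; rfl) h

theorem Solves.read {T : ℕ} {l l' : A.Label} {μ' : Mem W (s + (s + 2))} {b : Fin 2}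
    {d a : Fin (s + (s + 2))} (hl : A.code W l = .read b d a l')
    (h : A.Solves hW f μ₀ i y T l' (Function.update μ' d
      (Fin.ofNat (2 ^ W) ((![asOracle f, fun _ => (y : ℕ)] : Fin 2 → ℕ → ℕ) b (μ' a))))) :
    A.Solves hW f μ₀ i y (T + 1) l μ' :=
  Program.EndsWithin.step (P := A.inverter W hW)
    (show (A.code W l).exec _ _ = _ by rw [hl]; rfl) h

theorem solves_answer {μ' : Mem W (s + (s + 2))} (h : IsInversion f y (μ' tmpCell))
    (hr : Ready μ₀ i μ') : A.Solves hW f μ₀ i y 1 .answer μ' :=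
  Program.EndsWithin.halt (P := A.inverter W hW)
    (show (A.code W .answer).exec _ _ = _ from rfl) ⟨h, hr⟩

theorem solves_fail {μ' : Mem W (s + (s + 2))} (h : ∀ x, f x ≠ y)
    (hr : Ready μ₀ i μ') : A.Solves hW f μ₀ i y 2 .fail μ' := by
  refine Solves.op rfl (solves_answer ?_ (hr.update_tmp _))
  refine .inr ⟨by simp, fun x hx => h x (Fin.ext hx)⟩

theorem solves_found (hN : N < 2 ^ W) {x : Fin N} {μ' : Mem W (s + (s + 2))} (h : f x = y)
    (hr : Ready μ₀ i μ') : A.Solves hW f μ₀ i y 2 (.found x) μ' := by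
  refine Solves.op rfl (solves_answer ?_ (hr.update_tmp _))
  refine .inl ⟨x, ?_, congrArg _ h⟩
  rw [Function.update_self, Word.val_ofNat_of_lt (by omega)]

/-- The simulation of a run: the program goes on with the next phase, unless it meets a preimage of
`y`. If no preimage is met, then the run does not depend on the blocks of `y`. -/
theorem simulate_run (hwW : w ≤ W) (hN : N < 2 ^ W) (p : Option (Fin n)) {T : ℕ}
    {l : (A.prog p).Λ} {μ ν : Mem w s} {t : ℕ} {o : Word w}
    (hr : (A.prog p).RunsFrom ![blockRef f (A.strings i), A.port i y p] l μ t o ν)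
    {μ' : Mem W (s + (s + 2))} (hμ : Represents μ₀ i μ μ')
    (hT : (A.prog p).RunsFrom
        ![blockRef f (Function.update (A.strings i) y fun _ => false), A.port i y p] l μ t o ν →
      ∀ ν', Represents μ₀ i ν ν' → A.Solves hW f μ₀ i y T (A.follow i y p o) ν') :
    A.Solves hW f μ₀ i y (T + 6 * t) (.main i y p l) μ' := by
  induction hr generalizing μ' with
  | @halt l μ o h =>
    match hc : (A.prog p).code l with
    | .halt a =>
      rw [hc] at h
      simp only [Instr.exec, Sum.inr.injEq] at h
      subst h
      refine Solves.mono (Solves.branch (next := fun v => A.follow i y p (v.cast w))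
        (a := workCell a) (T := T) (by simp only [code, hc]) ?_) (by omega)
      rw [hμ.work]
      exact hT (.halt (by rw [hc]; rfl)) _ hμ
    | .op .. | .load .. | .store .. | .read .. | .branch .. => simp [hc, Instr.exec] at h
  | @step l l' μ μ₁ ν t o h hr ih =>
    -- It remains to check in each case that the instruction has the same effect when the blocks of
    -- `y` are erased (`he`). This can fail only for a read that hits such a block, and then the
    -- simulation stops.
    have hS {v} {μ₂} (hμ₂ : Represents μ₀ i μ₁ μ₂) (hv : v = l')
        (he : ((A.prog p).code l).exec ![blockRef f (Function.update (A.strings i) y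
          fun _ => false), A.port i y p] μ = .inl (l', μ₁)) :
        A.Solves hW f μ₀ i y (T + 6 * t) (.main i y p v) μ₂ := by
      subst hv
      exact ih hμ₂ fun hr' => hT (.step he hr')
    match hc : (A.prog p).code l with
    | .halt a => simp [hc, Instr.exec] at h
    | .op g dst a b next =>
      simp only [hc, Instr.exec, Sum.inl.injEq, Prod.mk.injEq] at h
      obtain ⟨h1, rfl⟩ := h
      refine Solves.mono (T := T + 6 * t + 1) (Solves.op (by simp only [code, hc]; rfl)
        (hS (hμ.update_work dst ?_) h1 ?_)) (by omega)
      · rw [Word.cast_cast hwW, hμ.work, hμ.work]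
      · rw [hc, ← h1]; rfl
    | .branch a next =>
      simp only [hc, Instr.exec, Sum.inl.injEq, Prod.mk.injEq] at h
      obtain ⟨h1, rfl⟩ := h
      refine Solves.mono (T := T + 6 * t + 1) (Solves.branch (by simp only [code, hc]; rfl)
        ?_) (by omega)
      rw [hμ.work]
      refine hS hμ h1 ?_
      rw [hc, ← h1]; rfl
    | .load dst ptr next =>
      simp only [hc, Instr.exec, Sum.inl.injEq, Prod.mk.injEq] at h
      obtain ⟨h1, rfl⟩ := h
      refine Solves.mono (T := T + 6 * t + 1 + 1) (Solves.branch (by simp only [code, hc]; rfl)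
        ?_) (by omega)
      rw [hμ.work]
      by_cases hv : (μ ptr : ℕ) < s
      · simp only [hv, dite_true] at hS
        refine Solves.op (by simp only [code, hc, hv, dite_true]; rfl)
          (hS (hμ.update_work dst (hμ.work _)) h1 ?_)
        rw [hc, ← h1]; simp [Instr.exec, hv]
      · simp only [hv, dite_false] at hS
        refine Solves.op (by simp only [code, hc, hv, dite_false]; rfl)
          (hS (hμ.update_work dst (Word.cast_cast hwW _)) h1 ?_)
        rw [hc, ← h1]; simp [Instr.exec, hv]
    | .store ptr src next =>
      simp only [hc, Instr.exec, Sum.inl.injEq, Prod.mk.injEq] at h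
      obtain ⟨h1, rfl⟩ := h
      refine Solves.mono (T := T + 6 * t + 1 + 1) (Solves.branch (by simp only [code, hc]; rfl)
        ?_) (by omega)
      rw [hμ.work]
      by_cases hv : (μ ptr : ℕ) < s
      · simp only [hv, dite_true] at hS
        refine Solves.op (by simp only [code, hc, hv, dite_true]; rfl)
          (hS (hμ.update_work _ (hμ.work _)) h1 ?_)
        rw [hc, ← h1]; simp [Instr.exec, hv]
      · simp only [hv, dite_false] at hS
        refine Solves.branch (by simp only [code, hc, hv, dite_false]; rfl) (hS hμ h1 ?_)
        rw [hc, ← h1]; simp [Instr.exec, hv]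
    | .read b dst ptr next =>
      simp only [hc, Instr.exec, Sum.inl.injEq, Prod.mk.injEq] at h
      obtain ⟨h1, rfl⟩ := h
      by_cases hv : b = 0 ∧ (μ ptr : ℕ) < N * n
      · obtain ⟨rfl, hv⟩ := hv
        have hx : (μ ptr : ℕ) / n < N := Nat.div_lt_of_lt_mul (by rwa [mul_comm])
        have hfx := asOracle_lt f hx
        -- The five steps are `main`, `addr`, `fetch`, `test`, `put`. After a hit, `found` and
        -- `answer` replace `put`; the extra step is covered since the remaining run has `t > 0`.
        refine Solves.mono (T := T + 6 * t + 1 + 1 + 1 + 1 + 1)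
          (Solves.branch (by simp only [code, hc]; rfl) ?_) (by omega)
        rw [hμ.work]
        refine Solves.op (by simp only [code, hc, hv, true_and, if_true]; rfl) ?_
        refine Solves.read rfl (Solves.branch rfl ?_)
        simp only [Function.update_self, Function.update_idem, Word.val_ofNat_of_lt (hx.trans hN),
          Matrix.cons_val_zero, Word.val_ofNat_of_lt (hfx.trans hN)]
        by_cases hy : asOracle f ((μ ptr : ℕ) / n) = y
        · rw [if_pos hy, dif_pos hx]
          refine Solves.mono (solves_found hN (Fin.ext ?_) (hμ.toReady.update_tmp _)) ?_
          · simpa [asOracle, hx] using hy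
          · have := hr.pos
            omega
        · rw [if_neg hy]
          refine Solves.op (by simp only [code, hc]; rfl)
            (hS ((hμ.update_tmp _).update_work dst ?_) h1 ?_)
          · rw [Word.cast_cast hwW]
            simp [blockRef, hv]
          · rw [hc, ← h1]
            simp [Instr.exec, blockRef, hv, blockBit_update _ _ _ _ hy]
      · refine Solves.mono (T := T + 6 * t + 1 + 1) (Solves.branch (by simp only [code, hc]; rfl)
          ?_) (by omega)
        rw [hμ.work]
        have hval (F : Fin N → Fin n → Bool) : (![blockRef f F, A.port i y p] : Fin 2 → ℕ → ℕ)
            b (μ ptr) = if b = 0 then 0 else A.port i y p (μ ptr) := by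
          fin_cases b
          · simp only [Fin.zero_eta, true_and] at hv
            simp [blockRef, hv]
          · simp
        simp only [hval] at hS
        refine Solves.op (by simp only [code, hc, hv, if_false]; rfl)
          (hS (hμ.update_work dst (Word.cast_cast hwW _)) h1 ?_)
        rw [hc, ← h1]
        simp only [Instr.exec, hval]

/-- The last query ends without a hit only if all queries are also served from the erased reference;
`hT` then makes the failure report correct. -/
theorem simulate_queries (hwW : w ≤ W) (hN : N < 2 ^ W) {T q r : ℕ} (hq : q + r = n)
    {μ : Mem w s} {ts : List ℕ}
    (hs : A.query.Serves (blockRef f (A.strings i)) (fun j o => o = blockBit (A.strings i) y j) μ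
      (List.range' q r) ts)
    {μ' : Mem W (s + (s + 2))} (hμ : Represents μ₀ i μ μ')
    (hT : A.query.Serves (blockRef f (Function.update (A.strings i) y fun _ => false))
        (fun j o => o = blockBit (A.strings i) y j) μ (List.range' q r) ts → ∀ x, f x ≠ y)
    (hTs : 2 + 6 * ts.sum ≤ T) :
    A.Solves hW f μ₀ i y T (A.enter i y q) μ' := by
  induction r generalizing q μ μ' ts T with
  | zero =>
    cases hs
    rw [enter, dif_neg (by omega)]
    exact (solves_fail (hT (.nil _)) hμ.toReady).mono (by omega)
  | succ r ih =>
    rw [List.range'_succ] at hs hT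
    cases hs with
    | @cons _ ν _ t o _ ts hr hg hs =>
      have hqn : q < n := by omega
      rw [enter, dif_pos hqn]
      simp only [List.sum_cons] at hTs
      refine Solves.mono (T := 2 + 6 * ts.sum + 6 * t) ?_ (by omega)
      refine simulate_run (p := some ⟨q, hqn⟩) hwW hN hr hμ fun hr' ν' hν => ?_
      exact ih (q := q + 1) (by omega) hs hν (fun hs' => hT (.cons hr' hg hs')) le_rfl

/-- Every inversion starts by restoring the preprocessed memory. It is thus independent of its
predecessors, and the amortized bound for one construction with `n` queries becomes a worst-case
bound. -/
theorem simulate_copy {T j : ℕ} (hwW : w ≤ W) (hj : j < s + 1) {μ' : Mem W (s + (s + 2))}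
    (hμ : Ready μ₀ i μ')
    (hw : ∀ c : Fin s, (c : ℕ) < j → (μ' (workCell c)).cast w = μ₀ c)
    (hT : ∀ ν', Represents μ₀ i μ₀ ν' →
      A.Solves hW f μ₀ i y T (.main i y none (A.prog none).start) ν') :
    A.Solves hW f μ₀ i y (T + (s + 1 - j)) (.copy i y ⟨j, hj⟩) μ' := by
  obtain ⟨d, hd⟩ : ∃ d, j + d = s := ⟨s - j, by omega⟩
  induction d generalizing j μ' with
  | zero =>
    refine Solves.mono (T := T + 1) (Solves.branch (by rw [code, dif_neg (by simp; omega)]) ?_)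
      (by omega)
    exact hT _ ⟨hμ, fun c => hw c (by omega)⟩
  | succ d ih =>
    have hjs : j < s := by omega
    refine Solves.mono (T := T + (s + 1 - (j + 1)) + 1)
      (Solves.op (by rw [code, dif_pos hjs]) ?_) (by omega)
    refine ih (by omega) (hμ.update_work _ _) (fun c hc => ?_) (by omega)
    by_cases hcj : c = ⟨j, hjs⟩
    · subst hcj
      rw [Function.update_self, hμ.saved, Word.cast_cast hwW]
    · have : (c : ℕ) ≠ j := fun h => hcj (Fin.ext h)
      rw [Function.update_of_ne (by simpa using hcj), hw c (by omega)]

/-- The simulation of a random access data structure for the `y`-th string of an incompressible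
collection inverts `f` at `y`. -/
theorem solves_start (hwW : w ≤ W) (hN : N < 2 ^ W) (hf : Incompressible A.query f (A.strings i))
    {t : ℕ} {h : Word w} {μ : Mem w s}
    (hb : A.build.Runs ![blockRef f (A.strings i), blockBit (A.strings i) y] μ₀ t h μ)
    (hh : (h : ℕ) ≠ n → ∀ x, f x ≠ y) {B : ℕ} (htB : t ≤ B)
    (hq : (h : ℕ) = n → ∃ ts, A.query.Serves (blockRef f (A.strings i))
      (fun j o => o = blockBit (A.strings i) y j) μ (List.range n) ts ∧ t + ts.sum ≤ B)
    {μ' : Mem W (s + (s + 2))} (hμ : Ready μ₀ i μ') :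
    A.Solves hW f μ₀ i y (s + 6 + 6 * B) .start μ' := by
  have hyW : (y : ℕ) < 2 ^ W := y.2.trans hN
  have hiW : (i : ℕ) < 2 ^ W := i.2.trans hN
  refine Solves.mono (T := (2 + 6 * B) + (s + 1 - 0) + 1 + 1 + 1) (Solves.read rfl
    (Solves.branch rfl ?_)) (by omega)
  simp only [Function.update_self, Matrix.cons_val_one, Matrix.cons_val_zero,
    Word.val_ofNat_of_lt hyW, Fin.is_lt, dite_true, Fin.eta]
  have hμ := hμ.update_tmp (Fin.ofNat (2 ^ W) y)
  refine Solves.branch rfl ?_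
  simp only [hμ.seed, Word.val_ofNat_of_lt hiW, Fin.is_lt, dite_true, Fin.eta]
  refine simulate_copy hwW (by omega) hμ (fun c hc => absurd hc (Nat.not_lt_zero _))
    fun ν' hν => ?_
  refine Solves.mono (T := (2 + 6 * (B - t)) + 6 * t) ?_ (by omega)
  -- The erased run of the construction is discarded: incompressibility covers every memory content,
  -- however it arose.
  refine simulate_run (p := none) hwW hN hb hν fun _ ν' hν => ?_
  unfold follow
  split_ifs with hn
  · obtain ⟨ts, hs, hB⟩ := hq hn
    rw [List.range_eq_range'] at hs
    refine simulate_queries hwW hN (Nat.zero_add n) hs hν (fun hs' => ?_) (by omega)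
    rw [← List.range_eq_range'] at hs'
    -- Serving all queries without the blocks of `y` would decode the `y`-th string, so a preimage
    -- must have been met before.
    exact absurd ⟨ts, hs'⟩ (hf y μ)
  · exact (solves_fail (hh hn) hν.toReady).mono (by omega)

end Simulation

end InversionData

/-! ### From random access to function inversion -/

/-- A program inverts all functions if it answers every query from a class of memory contents that
it preserves. -/
theorem Program.Inverts.of_invariant {w s N t : ℕ} {P : Program w s}
    (h : ∀ f : Fin N → Fin N, ∃ (μ : Mem w s) (I : Mem w s → Prop), I μ ∧ ∀ (y : Fin N) ν, I ν →
      P.EndsWithin ![asOracle f, fun _ => y] (fun o ν' => IsInversion f y o ∧ I ν') t P.start ν) :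
    P.Inverts N t := by
  intro f
  obtain ⟨μ, I, hμ, hI⟩ := h f
  refine ⟨μ, fun ys => ?_⟩
  induction ys generalizing μ with
  | nil => exact fun _ => ⟨[], .nil _, by simp⟩
  | cons y ys ih =>
    intro hy
    obtain ⟨u, hu, o, ν, hr, hg, hν⟩ := hI ⟨y, hy y (by simp)⟩ μ hμ
    obtain ⟨ts, hs, hts⟩ := ih ν hν fun z hz => hy z (by simp [hz])
    exact ⟨u :: ts, .cons hr hg hs, by simpa using ⟨hu, hts⟩⟩

/-- Function inversion from a random access data structure for references of length `m ≥ N * n` and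
texts of length `n`. -/
theorem RAStructure.Correct.exists_inverts {σ w s k m tc tq N n a : ℕ} {L : ℝ}
    {D : RAStructure σ w s} (hD : D.Correct k m L tc tq) (hσ : 2 ≤ σ) (hN : 0 < N)
    (hnL : (n : ℝ) ≤ L) (hm : N * n ≤ m) (hcount : N * N * 2 ^ (w * s) < 2 ^ n)
    (hNa : N < 2 ^ a) (hna : n < 2 ^ a) (hsa : s < 2 ^ a) (hwa : w ≤ a) :
    ∃ P : Program (5 * a + 4) (s + (s + 2)), P.Inverts N (s + 6 + 6 * (tc + n * tq)) := by
  obtain ⟨S, hS⟩ := exists_incompressible_family hN hcount (D.query n)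
  let A : InversionData w s N n := ⟨D.build n, D.query n, S⟩
  have hW := A.card_label_le hNa hna hsa hwa
  have hNW : N < 2 ^ (5 * a + 4) := hNa.trans_le (Nat.pow_le_pow_right (by norm_num) (by omega))
  refine ⟨A.inverter _ hW, .of_invariant fun f => ?_⟩
  obtain ⟨i, hi⟩ := hS f
  let R : List (Fin σ) := stringOf m (blockRef f (S i)) fun j => (blockRef_lt_two _ _ _).trans_le hσ
  have hR : asInput R = blockRef f (S i) := asInput_stringOf fun j hj => by
    rw [blockRef, if_neg (by omega)]
  let μ₀ := D.prep R
  refine ⟨fun c => if c = seedCell then Fin.ofNat _ i else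
    if h : ∃ j, c = savedCell j then (μ₀ h.choose).cast _ else 0,
    InversionData.Ready μ₀ i, ⟨fun j => ?_, by simp⟩, fun y ν hν => ?_⟩
  · have hj : ∃ j', savedCell j = savedCell j' := ⟨j, rfl⟩
    have hc : hj.choose = j := by
      simp [savedCell, memCell_injective.eq_iff]
    have hne : (savedCell j : Fin (s + (s + 2))) ≠ seedCell := by
      simp [savedCell, seedCell, memCell_injective.eq_iff]
    simp only [hne, if_false, hj, dite_true, hc]
  · let T : List (Fin σ) := stringOf n (blockBit (S i) y) fun j => (blockBit_lt_two _ _ _).trans_le hσ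
    have hTl : T.length = n := length_stringOf
    have hT : asInput T = blockBit (S i) y := asInput_stringOf fun j hj => by
      rw [blockBit, dif_neg (by omega)]
    obtain ⟨t, h, μ, hb, hhn, hfac, hq⟩ := hD R T length_stringOf (by rwa [hTl])
    rw [hR] at hb hq
    rw [hT, hTl] at hb hq
    rw [hTl] at hhn hfac
    refine InversionData.solves_start (A := A) (B := tc + n * tq) (by omega) hNW hi hb ?_ ?_ ?_ hν
    · intro hne x hx
      -- For a preimage `x`, the text is block `x` of the reference, so all its suffixes are
      -- substrings.
      refine hfac (by omega) (.of_infix ((List.drop_suffix _ _).isInfix.trans ?_) k)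
      refine stringOf_infix (d := x * n) ?_ fun j hj => ?_
      · refine le_trans ?_ hm
        calc (x : ℕ) * n + n = (x + 1) * n := by ring
          _ ≤ N * n := Nat.mul_le_mul_right _ x.2
      · rw [blockRef_mul_add _ _ _ hj, hx]
    -- The empty sequence of queries bounds the construction alone.
    · obtain ⟨ts, -, hts⟩ := hq [] (by simp)
      simp at hts
      omega
    · intro hh
      obtain ⟨ts, hs, hts⟩ := hq (List.range n) (by simp; omega)
      exact ⟨ts, hs, by simpa using hts⟩

/-- The program that looks up the answers in a table. -/
theorem exists_inverts (N : ℕ) : ∃ P : Program (N + 2) (N + 1), P.Inverts N 3 := by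
  have hN2 : N + 2 < 2 ^ (N + 2) := Nat.lt_two_pow_self
  let tmp : Fin (N + 1) := Fin.last N
  let P : Program (N + 2) (N + 1) :=
    { Λ := Fin 3
      card_le := by rw [Fintype.card_fin, pow_add]; have := Nat.one_le_two_pow (n := N); omega
      start := 0
      code := ![.read 1 tmp tmp 1, .load tmp tmp 2, .halt tmp] }
  refine ⟨P, .of_invariant fun f => ?_⟩
  classical
  have hinv (y : Fin N) : ∃ o : ℕ, o < 2 ^ (N + 2) ∧ IsInversion f y o := by
    by_cases h : ∃ x, f x = y
    · obtain ⟨x, hx⟩ := h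
      exact ⟨x + 1, by omega, .inl ⟨x, rfl, congrArg _ hx⟩⟩
    · push Not at h
      exact ⟨0, by positivity, .inr ⟨rfl, fun x hx => h x (Fin.ext hx)⟩⟩
  choose o ho hi using hinv
  let I : Mem (N + 2) (N + 1) → Prop := fun μ => ∀ y : Fin N, (μ y.castSucc : ℕ) = o y
  refine ⟨fun c => if h : (c : ℕ) < N then ⟨o ⟨c, h⟩, ho _⟩ else 0, I, fun y => by simp,
    fun y ν hν => ?_⟩
  have hI (x) : I (Function.update ν tmp x) := fun z => by
    rw [Function.update_of_ne (by simp [tmp, Fin.ext_iff]; omega)]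
    exact hν z
  have hy : (Fin.ofNat (2 ^ (N + 2)) y : ℕ) = y := Word.val_ofNat_of_lt (by omega)
  refine Program.EndsWithin.step (P := P) (l' := (1 : Fin 3))
    (μ' := Function.update ν tmp (Fin.ofNat _ y)) rfl ?_
  refine Program.EndsWithin.step (P := P) (l' := (2 : Fin 3))
    (μ' := Function.update ν tmp (ν y.castSucc)) ?_ ?_
  · change Instr.exec _ _ (.load tmp tmp 2) = _
    have h1 : (y : ℕ) < N + 1 := by omega
    have h2 : (y.castSucc : Fin (N + 1)) ≠ tmp := by simp [tmp, Fin.ext_iff]; omega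
    simp only [Instr.exec, Function.update_self, hy, h1, dite_true, Function.update_idem]
    change Sum.inl ((2 : Fin 3), Function.update ν tmp (Function.update ν tmp _ y.castSucc)) = _
    rw [Function.update_of_ne h2]
  · refine Program.EndsWithin.halt (o := ν y.castSucc) ?_ ⟨?_, hI _⟩
    · change Instr.exec _ _ (.halt tmp) = _
      simp [Instr.exec]
    · rw [hν y]
      exact hi y

/-! ### Asymptotic bounds -/

theorem eventually_log_ge (c : ℝ) : ∀ᶠ n : ℕ in atTop, c ≤ Real.log n :=
  (Real.tendsto_log_atTop.comp tendsto_natCast_atTop_atTop).eventually_ge_atTop c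

theorem isBigO_mul_log_pow (f : ℕ → ℝ) {c d : ℕ} (h : c ≤ d) :
    (fun n => f n * Real.log n ^ c) =O[atTop] fun n => f n * Real.log n ^ d := by
  refine (isBigO_refl f _).mul (.of_bound 1 ?_)
  filter_upwards [eventually_log_ge 1] with n hn
  rw [one_mul, Real.norm_of_nonneg (by positivity), Real.norm_of_nonneg (by positivity)]
  exact pow_le_pow_right₀ hn h

theorem IsSoftO.of_isBigO {g f : ℕ → ℝ} (h : g =O[atTop] f) : IsSoftO g f :=
  ⟨0, by simpa using h⟩

theorem IsSoftO.add {g₁ g₂ f : ℕ → ℝ} (h₁ : IsSoftO g₁ f) (h₂ : IsSoftO g₂ f) :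
    IsSoftO (fun n => g₁ n + g₂ n) f := by
  obtain ⟨c, h₁⟩ := h₁
  obtain ⟨d, h₂⟩ := h₂
  exact ⟨c + d, (h₁.trans (isBigO_mul_log_pow f (Nat.le_add_right c d))).add
    (h₂.trans (isBigO_mul_log_pow f (Nat.le_add_left d c)))⟩

theorem IsSoftO.mul {g₁ g₂ f₁ f₂ : ℕ → ℝ} (h₁ : IsSoftO g₁ f₁) (h₂ : IsSoftO g₂ f₂) :
    IsSoftO (fun n => g₁ n * g₂ n) fun n => f₁ n * f₂ n := by
  obtain ⟨c, h₁⟩ := h₁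
  obtain ⟨d, h₂⟩ := h₂
  exact ⟨c + d, (h₁.mul h₂).congr_right fun n => by ring⟩

theorem IsSoftO.isBigO_trans {g g' f : ℕ → ℝ} (hg : g' =O[atTop] g) (h : IsSoftO g f) :
    IsSoftO g' f :=
  let ⟨c, hc⟩ := h
  ⟨c, hg.trans hc⟩

theorem IsSoftO.trans_isBigO {g f f' : ℕ → ℝ} (h : IsSoftO g f) (hf : f =O[atTop] f') :
    IsSoftO g f' :=
  let ⟨c, hc⟩ := h
  ⟨c, hc.trans (hf.mul (isBigO_refl _ _))⟩

theorem IsSoftO.congr' {g g' f : ℕ → ℝ} (h : IsSoftO g f) (hg : g =ᶠ[atTop] g') :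
    IsSoftO g' f :=
  h.isBigO_trans hg.symm.isBigO

theorem isSoftO_log : IsSoftO (fun n => Real.log n) fun _ => 1 :=
  ⟨1, by simpa using isBigO_refl _ _⟩

/-- The length of the reference for the inversion of functions on `[N]`. -/
noncomputable def refLength (χ : ℝ) (N : ℕ) : ℕ :=
  ⌈((N : ℝ) * Real.log N ^ 2) ^ (1 - χ)⁻¹⌉₊

section RefLength

variable {χ : ℝ}

theorem refLength_bounds (hχ0 : 0 < χ) (hχ1 : χ < 1) : ∀ᶠ N : ℕ in atTop,
    ((N : ℝ) * Real.log N ^ 2) ^ (1 - χ)⁻¹ ≤ refLength χ N ∧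
    (refLength χ N : ℝ) ≤ 2 * ((N : ℝ) * Real.log N ^ 2) ^ (1 - χ)⁻¹ ∧ N ≤ refLength χ N := by
  have hα : 1 ≤ (1 - χ)⁻¹ := (one_le_inv₀ (by linarith)).2 (by linarith)
  filter_upwards [eventually_log_ge 1, eventually_ge_atTop 1] with N hN hN1
  have hN1' : (1 : ℝ) ≤ N := by exact_mod_cast hN1
  have hX : (N : ℝ) ≤ N * Real.log N ^ 2 :=
    le_mul_of_one_le_right (by positivity) (one_le_pow₀ hN)
  have hX2 : (N : ℝ) * Real.log N ^ 2 ≤ ((N : ℝ) * Real.log N ^ 2) ^ (1 - χ)⁻¹ :=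
    Real.self_le_rpow_of_one_le (hN1'.trans hX) hα
  have h1 := Nat.le_ceil (((N : ℝ) * Real.log N ^ 2) ^ (1 - χ)⁻¹)
  have h2 := Nat.ceil_lt_add_one (a := ((N : ℝ) * Real.log N ^ 2) ^ (1 - χ)⁻¹) (by positivity)
  refine ⟨h1, ?_, ?_⟩
  · unfold refLength; linarith
  · exact_mod_cast (hX.trans hX2).trans h1

theorem tendsto_refLength (hχ0 : 0 < χ) (hχ1 : χ < 1) : Tendsto (refLength χ) atTop atTop :=
  tendsto_atTop_mono' _ ((refLength_bounds hχ0 hχ1).mono fun _ h => h.2.2) tendsto_id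

/-- The crude bound `N log² N ≤ N³` suffices, since only the order of the logarithm matters. -/
theorem log_refLength_le (hχ0 : 0 < χ) (hχ1 : χ < 1) : ∀ᶠ N : ℕ in atTop,
    Real.log N ≤ Real.log (refLength χ N) ∧
    Real.log (refLength χ N) ≤ (1 + 3 * (1 - χ)⁻¹) * Real.log N := by
  have hα : 0 < (1 - χ)⁻¹ := inv_pos.2 (by linarith)
  filter_upwards [refLength_bounds hχ0 hχ1, eventually_log_ge 1, eventually_ge_atTop 1] with
    N ⟨_, h2, h3⟩ hN hN1
  have hN0 : (0 : ℝ) < N := by exact_mod_cast hN1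
  refine ⟨Real.log_le_log hN0 (by exact_mod_cast h3), ?_⟩
  have hlog : Real.log N ≤ N := (Real.log_le_sub_one_of_pos hN0).trans (by linarith)
  have hX : (N : ℝ) * Real.log N ^ 2 ≤ (N : ℝ) ^ 3 := by
    calc (N : ℝ) * Real.log N ^ 2 ≤ N * (N : ℝ) ^ 2 := by gcongr
      _ = _ := by ring
  have hX0 : 0 < (N : ℝ) * Real.log N ^ 2 := by positivity
  have hm0 : (0 : ℝ) < refLength χ N := hN0.trans_le (by exact_mod_cast h3)
  calc Real.log (refLength χ N) ≤ Real.log (2 * ((N : ℝ) ^ 3) ^ (1 - χ)⁻¹) := by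
        refine Real.log_le_log hm0 (h2.trans ?_)
        gcongr
    _ = Real.log 2 + (1 - χ)⁻¹ * (3 * Real.log N) := by
        rw [Real.log_mul (by norm_num) (by positivity), Real.log_rpow (by positivity),
          Real.log_pow]
        norm_num
    _ ≤ _ := by
        have := Real.log_two_lt_d9
        nlinarith

/-- With `m` the reference length, `m^(1-χ) ≥ N log² N ≥ N log m`. The second logarithm in
`refLength` absorbs the constant in `log m = O(log N)`. -/
theorem mul_le_refLength (hχ0 : 0 < χ) (hχ1 : χ < 1) : ∀ᶠ N : ℕ in atTop,
    N * ⌊(refLength χ N : ℝ) ^ χ * Real.log (refLength χ N)⌋₊ ≤ refLength χ N := by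
  filter_upwards [refLength_bounds hχ0 hχ1, log_refLength_le hχ0 hχ1,
    eventually_log_ge (1 + 3 * (1 - χ)⁻¹), eventually_log_ge 1, eventually_ge_atTop 1] with
    N ⟨h1, _, h3⟩ ⟨h4, h5⟩ hN hN' hN1
  have hN0 : (0 : ℝ) < N := by exact_mod_cast hN1
  set m := refLength χ N
  have hm0 : (0 : ℝ) < m := hN0.trans_le (by exact_mod_cast h3)
  have hlog : 0 ≤ Real.log m := by linarith
  have hX0 : 0 ≤ (N : ℝ) * Real.log N ^ 2 := by positivity
  have h6 : (N : ℝ) * Real.log N ^ 2 ≤ (m : ℝ) ^ (1 - χ) := by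
    have := Real.rpow_le_rpow (by positivity) h1 (by linarith : 0 ≤ 1 - χ)
    rwa [← Real.rpow_mul hX0, inv_mul_cancel₀ (by linarith), Real.rpow_one] at this
  have h7 : Real.log m ≤ Real.log N ^ 2 := by
    rw [sq]
    exact h5.trans (mul_le_mul_of_nonneg_right hN (by linarith))
  have h8 : (N : ℝ) * ⌊(m : ℝ) ^ χ * Real.log m⌋₊ ≤ m := by
    calc (N : ℝ) * ⌊(m : ℝ) ^ χ * Real.log m⌋₊ ≤ N * ((m : ℝ) ^ χ * Real.log m) := by
          gcongr
          exact Nat.floor_le (by positivity)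
      _ = (N * Real.log m) * (m : ℝ) ^ χ := by ring
      _ ≤ (N * Real.log N ^ 2) * (m : ℝ) ^ χ := by gcongr
      _ ≤ (m : ℝ) ^ (1 - χ) * (m : ℝ) ^ χ := by gcongr
      _ = m := by rw [← Real.rpow_add hm0]; simp
  exact_mod_cast h8

theorem isTheta_log_refLength (hχ0 : 0 < χ) (hχ1 : χ < 1) :
    (fun N => Real.log (refLength χ N)) =Θ[atTop] fun N : ℕ => Real.log N := by
  constructor
  · refine .of_bound (1 + 3 * (1 - χ)⁻¹) ?_
    filter_upwards [log_refLength_le hχ0 hχ1, eventually_log_ge 1] with N ⟨h1, h2⟩ hN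
    rwa [Real.norm_of_nonneg (by linarith), Real.norm_of_nonneg (by linarith)]
  · refine .of_bound 1 ?_
    filter_upwards [log_refLength_le hχ0 hχ1, eventually_log_ge 1] with N ⟨h1, h2⟩ hN
    rwa [Real.norm_of_nonneg (by linarith), Real.norm_of_nonneg (by linarith), one_mul]

theorem isSoftO_refLength_rpow (hχ0 : 0 < χ) (hχ1 : χ < 1) {e : ℝ} (he : 0 ≤ e) :
    IsSoftO (fun N => (refLength χ N : ℝ) ^ e) fun N => (N : ℝ) ^ (e / (1 - χ)) := by
  refine ⟨2 * ⌈(1 - χ)⁻¹ * e⌉₊, .of_bound (2 ^ e) ?_⟩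
  filter_upwards [refLength_bounds hχ0 hχ1, eventually_log_ge 1] with N ⟨_, h2, _⟩ hN
  have hX0 : 0 ≤ (N : ℝ) * Real.log N ^ 2 := by positivity
  rw [Real.norm_of_nonneg (by positivity), Real.norm_of_nonneg (by positivity)]
  calc (refLength χ N : ℝ) ^ e ≤ (2 * ((N : ℝ) * Real.log N ^ 2) ^ (1 - χ)⁻¹) ^ e := by gcongr
    _ = 2 ^ e * ((N : ℝ) ^ (e / (1 - χ)) * (Real.log N ^ 2) ^ ((1 - χ)⁻¹ * e)) := by
        rw [Real.mul_rpow (by norm_num) (by positivity), ← Real.rpow_mul hX0,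
          Real.mul_rpow (by positivity) (by positivity), div_eq_mul_inv, mul_comm e]
    _ ≤ 2 ^ e * ((N : ℝ) ^ (e / (1 - χ)) * Real.log N ^ (2 * ⌈(1 - χ)⁻¹ * e⌉₊)) := by
        rw [pow_mul, ← Real.rpow_natCast (Real.log N ^ 2)]
        gcongr
        · exact one_le_pow₀ hN
        · exact Nat.le_ceil _

/-- Converts bounds in `m` into bounds in `N`; this is where all exponents are divided by `1 - χ`.
-/
theorem IsSoftO.comp_refLength (hχ0 : 0 < χ) (hχ1 : χ < 1) {e : ℝ} (he : 0 ≤ e) {g : ℕ → ℝ}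
    (h : IsSoftO g fun m => (m : ℝ) ^ e) :
    IsSoftO (fun N => g (refLength χ N)) fun N => (N : ℝ) ^ (e / (1 - χ)) := by
  obtain ⟨c, hc⟩ := h
  obtain ⟨d, hd⟩ := isSoftO_refLength_rpow hχ0 hχ1 he
  refine ⟨d + c, (hc.comp_tendsto (tendsto_refLength hχ0 hχ1)).trans ?_⟩
  exact (hd.mul ((isTheta_log_refLength hχ0 hχ1).1.pow c)).congr_right fun N => by ring

end RefLength

theorem isBigO_natLog : (fun m : ℕ => (Nat.log 2 m : ℝ)) =O[atTop] fun m => Real.log m := by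
  refine .of_bound 2 ?_
  filter_upwards [eventually_log_ge 1] with m hm
  rw [Real.norm_of_nonneg (by positivity), Real.norm_of_nonneg (by linarith)]
  refine (Real.natLog_le_logb m 2).trans ?_
  rw [Real.logb, div_le_iff₀ (by simp [Real.log_pos])]
  have := Real.log_two_gt_d9
  push_cast
  nlinarith

theorem isBigO_const_log (c : ℝ) : (fun _ : ℕ => c) =O[atTop] fun m : ℕ => Real.log m := by
  refine .of_bound |c| ?_
  filter_upwards [eventually_log_ge 1] with m hm
  rw [Real.norm_of_nonneg (by linarith : 0 ≤ Real.log m), Real.norm_eq_abs]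
  exact le_mul_of_one_le_right (abs_nonneg _) hm

theorem isBigO_const_rpow (c : ℝ) {e : ℝ} (he : 0 ≤ e) :
    (fun _ : ℕ => c) =O[atTop] fun m : ℕ => (m : ℝ) ^ e := by
  refine .of_bound |c| ?_
  filter_upwards [eventually_ge_atTop 1] with m hm
  have hm : (1 : ℝ) ≤ m := by exact_mod_cast hm
  rw [Real.norm_of_nonneg (by positivity : 0 ≤ (m : ℝ) ^ e), Real.norm_eq_abs]
  exact le_mul_of_one_le_right (abs_nonneg _) (Real.one_le_rpow hm he)

/-! ### Space, time and word size in terms of the reference length -/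

section Parameters

variable {χ δ : ℝ} {w s tc tq : ℕ → ℕ}

/-- A number of bits that is sufficient for positions of the reference. -/
def addrBits (w : ℕ → ℕ) (m : ℕ) : ℕ := w m + Nat.log 2 m + 1

/-- The length of the texts. -/
noncomputable def textLength (χ : ℝ) (m : ℕ) : ℕ := ⌊(m : ℝ) ^ χ * Real.log m⌋₊

/-- The number of steps of an inversion. -/
noncomputable def inversionTime (χ : ℝ) (s tc tq : ℕ → ℕ) (m : ℕ) : ℕ :=
  s m + 6 + 6 * (tc m + textLength χ m * tq m)

theorem isTheta_wordSize (hw : (fun m => (w m : ℝ)) =Θ[atTop] fun m => Real.log m) :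
    (fun m => ((5 * addrBits w m + 4 : ℕ) : ℝ)) =Θ[atTop] fun m : ℕ => Real.log m := by
  constructor
  · have := (((hw.1.add isBigO_natLog).const_mul_left 5).add (isBigO_const_log 9))
    refine this.congr_left fun m => ?_
    simp only [addrBits]
    push_cast
    ring
  · refine hw.2.trans (.of_bound 1 (.of_forall fun m => ?_))
    rw [Real.norm_of_nonneg (by positivity), Real.norm_of_nonneg (by positivity), one_mul]
    exact_mod_cast (by unfold addrBits; omega : w m ≤ 5 * addrBits w m + 4)

theorem eventually_wordSize_pos (hw : (fun m => (w m : ℝ)) =Θ[atTop] fun m => Real.log m) :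
    ∀ᶠ m in atTop, 1 ≤ w m := by
  obtain ⟨c, hc⟩ := hw.2.bound
  filter_upwards [hc, eventually_log_ge 1] with m hm hlog
  by_contra h
  have h0 : w m = 0 := by omega
  rw [h0, Real.norm_of_nonneg (by linarith)] at hm
  simp at hm
  linarith

/-- Words eventually have at least one bit, so the number of cells is at most the number of bits. -/
theorem isBigO_memSize (hw : (fun m => (w m : ℝ)) =Θ[atTop] fun m => Real.log m)
    (hs : (fun m => (spaceBits (w m) (s m) : ℝ)) =O[atTop] fun m => (m : ℝ) ^ χ) :
    (fun m => (s m : ℝ)) =O[atTop] fun m => (m : ℝ) ^ χ := by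
  refine IsBigO.trans (.of_bound 1 ?_) hs
  filter_upwards [eventually_wordSize_pos hw] with m hm
  rw [Real.norm_of_nonneg (by positivity), Real.norm_of_nonneg (by positivity), one_mul]
  have : s m ≤ spaceBits (w m) (s m) := by
    unfold spaceBits
    nlinarith
  exact_mod_cast this

theorem isSoftO_space (hχ0 : 0 < χ)
    (hw : (fun m => (w m : ℝ)) =Θ[atTop] fun m => Real.log m)
    (hs : (fun m => (spaceBits (w m) (s m) : ℝ)) =O[atTop] fun m => (m : ℝ) ^ χ) :
    IsSoftO (fun m => (spaceBits (5 * addrBits w m + 4) (s m + (s m + 2)) : ℝ))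
      fun m => (m : ℝ) ^ χ := by
  have h1 := IsSoftO.of_isBigO (((isBigO_memSize hw hs).const_mul_left 2).add
    (isBigO_const_rpow 3 hχ0.le))
  have h2 := isSoftO_log.isBigO_trans (isTheta_wordSize hw).1
  have := h1.mul h2
  simp only [mul_one] at this
  refine this.congr' (.of_forall fun m => ?_)
  simp only [spaceBits]
  push_cast
  ring

theorem isSoftO_textLength : IsSoftO (fun m => (textLength χ m : ℝ)) fun m => (m : ℝ) ^ χ := by
  refine ⟨1, .of_bound 1 ?_⟩
  filter_upwards [eventually_log_ge 1] with m hm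
  rw [Real.norm_of_nonneg (by positivity), Real.norm_of_nonneg (by positivity), one_mul, pow_one]
  exact Nat.floor_le (by positivity)

/-- The construction and the `n` queries dominate; restoring the memory costs only `O(m^χ)`. -/
theorem isSoftO_inversionTime (hχ0 : 0 < χ) (hδ : 0 < δ)
    (hw : (fun m => (w m : ℝ)) =Θ[atTop] fun m => Real.log m)
    (hs : (fun m => (spaceBits (w m) (s m) : ℝ)) =O[atTop] fun m => (m : ℝ) ^ χ)
    (htq : IsSoftO (fun m => (tq m : ℝ)) fun m => (m : ℝ) ^ δ)
    (htc : IsSoftO (fun m => (tc m : ℝ)) fun m => (m : ℝ) ^ (χ + δ)) :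
    IsSoftO (fun m => (inversionTime χ s tc tq m : ℝ)) fun m => (m : ℝ) ^ (χ + δ) := by
  have h1 : (fun m => (s m : ℝ)) =O[atTop] fun m => (m : ℝ) ^ (χ + δ) := by
    refine (isBigO_memSize hw hs).trans (.of_bound 1 ?_)
    filter_upwards [eventually_ge_atTop 1] with m hm
    have hm : (1 : ℝ) ≤ m := by exact_mod_cast hm
    rw [Real.norm_of_nonneg (by positivity), Real.norm_of_nonneg (by positivity), one_mul]
    exact Real.rpow_le_rpow_of_exponent_le hm (by linarith)
  have h2 : IsSoftO (fun m => (textLength χ m : ℝ) * tq m) fun m => (m : ℝ) ^ (χ + δ) := by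
    refine ((isSoftO_textLength (χ := χ)).mul htq).trans_isBigO (EventuallyEq.isBigO ?_)
    filter_upwards [eventually_ge_atTop 1] with m hm
    rw [Real.rpow_add (by exact_mod_cast hm)]
  have h6 : (fun m => 6 * ((tc m : ℝ) + textLength χ m * tq m)) =O[atTop]
      fun m => (tc m : ℝ) + textLength χ m * tq m := (isBigO_refl _ _).const_mul_left 6
  refine ((IsSoftO.of_isBigO (h1.add (isBigO_const_rpow 6 (by linarith)))).add
    ((htc.add h2).isBigO_trans h6)).congr' (.of_forall fun m => ?_)
  simp only [inversionTime]
  push_cast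
  ring

/-- The texts are too long to be stored. -/
theorem eventually_space_lt_textLength (hχ0 : 0 < χ)
    (hs : (fun m => (spaceBits (w m) (s m) : ℝ)) =O[atTop] fun m => (m : ℝ) ^ χ) :
    ∀ᶠ m in atTop, 2 * (Nat.log 2 m + 1) + w m * s m ≤ textLength χ m := by
  obtain ⟨C, hC⟩ := hs.bound
  obtain ⟨K, hK⟩ := isBigO_natLog.bound
  have hlo : (fun m : ℕ => Real.log m) =O[atTop] fun m : ℕ => (m : ℝ) ^ χ :=
    ((isLittleO_log_rpow_atTop hχ0).comp_tendsto tendsto_natCast_atTop_atTop).isBigO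
  obtain ⟨C', hC'⟩ := (((isBigO_natLog.trans hlo).const_mul_left 2).add
    (isBigO_const_rpow 3 hχ0.le)).bound
  -- The logarithmic factor of the text length outgrows the constants of the space bound and of the
  -- additional logarithmic terms.
  filter_upwards [hC, hC', eventually_log_ge (C + C'), eventually_ge_atTop 1] with
    m h1 h2 h3 hm
  have hm : (1 : ℝ) ≤ m := by exact_mod_cast hm
  rw [Real.norm_of_nonneg (by positivity), Real.norm_of_nonneg (by positivity)] at h1 h2
  refine Nat.le_floor ?_
  have h4 : (w m * s m : ℝ) ≤ spaceBits (w m) (s m) := by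
    exact_mod_cast (by unfold spaceBits; nlinarith : w m * s m ≤ spaceBits (w m) (s m))
  have h5 := mul_le_mul_of_nonneg_left h3 (by positivity : 0 ≤ (m : ℝ) ^ χ)
  push_cast
  nlinarith

theorem eventually_memSize_le (hχ1 : χ < 1)
    (hw : (fun m => (w m : ℝ)) =Θ[atTop] fun m => Real.log m)
    (hs : (fun m => (spaceBits (w m) (s m) : ℝ)) =O[atTop] fun m => (m : ℝ) ^ χ) :
    ∀ᶠ m in atTop, s m ≤ m := by
  obtain ⟨C, hC⟩ := (isBigO_memSize hw hs).bound
  have hlo := ((tendsto_rpow_atTop (by linarith : 0 < 1 - χ)).comp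
    tendsto_natCast_atTop_atTop).eventually_ge_atTop C
  filter_upwards [hC, hlo, eventually_ge_atTop 1] with m h1 h2 hm
  have hm : (0 : ℝ) < m := by exact_mod_cast hm
  rw [Real.norm_natCast, Real.norm_of_nonneg (by positivity)] at h1
  have : (s m : ℝ) ≤ m := by
    calc (s m : ℝ) ≤ C * (m : ℝ) ^ χ := h1
      _ ≤ (m : ℝ) ^ (1 - χ) * (m : ℝ) ^ χ := by gcongr; exact h2
      _ = m := by rw [← Real.rpow_add hm]; simp
  exact_mod_cast this

end Parameters

theorem mainTheorem3 (χ δ : ℝ) (hχ0 : 0 < χ) (hχ1 : χ < 1) (hδ : 0 < δ) (k : ℕ)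
    -- alphabet size, word size, number of words, construction time, query time
    (σ w s tc tq : ℕ → ℕ) (hσ : ∀ m, 2 ≤ σ m)
    (hw : (fun m => (w m : ℝ)) =Θ[atTop] fun m => Real.log m)
    (hs : (fun m => (spaceBits (w m) (s m) : ℝ)) =O[atTop] fun m => (m : ℝ) ^ χ)
    (htq : IsSoftO (fun m => (tq m : ℝ)) fun m => (m : ℝ) ^ δ)
    (htc : IsSoftO (fun m => (tc m : ℝ)) fun m => (m : ℝ) ^ (χ + δ))
    (D : ∀ m, RAStructure (σ m) (w m) (s m))
    (hD : ∀ᶠ m in atTop, (D m).Correct k m ((m : ℝ) ^ χ * Real.log m) (tc m) (tq m)) :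
    ∃ w' s' t' : ℕ → ℕ,
      ((fun N => (w' N : ℝ)) =Θ[atTop] fun N => Real.log N) ∧
      IsSoftO (fun N => (spaceBits (w' N) (s' N) : ℝ)) (fun N => (N : ℝ) ^ (χ / (1 - χ))) ∧
      IsSoftO (fun N => (t' N : ℝ)) (fun N => (N : ℝ) ^ ((χ + δ) / (1 - χ))) ∧
      ∀ N, ∃ P : Program (w' N) (s' N), P.Inverts N (t' N) := by
  have hinv : ∀ᶠ m in atTop, ∀ N, 0 < N → N * textLength χ m ≤ m →
      ∃ P : Program (5 * addrBits w m + 4) (s m + (s m + 2)),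
        P.Inverts N (inversionTime χ s tc tq m) := by
    filter_upwards [hD, eventually_space_lt_textLength hχ0 hs,
      eventually_memSize_le hχ1 hw hs, eventually_log_ge 1] with m hD hn hsm hlog N hN hNm
    have hn0 : 0 < textLength χ m := by omega
    have hNm' : N ≤ m := (Nat.le_mul_of_pos_right N hn0).trans hNm
    have hnm' : textLength χ m ≤ m := (Nat.le_mul_of_pos_left _ hN).trans hNm
    have hpow : m < 2 ^ (Nat.log 2 m + 1) := Nat.lt_pow_succ_log_self (by norm_num) m
    have hpow' : m < 2 ^ addrBits w m :=
      hpow.trans_le (Nat.pow_le_pow_right (by norm_num) (by unfold addrBits; omega))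
    refine hD.exists_inverts (hσ m) hN (Nat.floor_le (by positivity)) hNm ?_
      (hNm'.trans_lt hpow') (hnm'.trans_lt hpow') (hsm.trans_lt hpow') (by unfold addrBits; omega)
    -- Since `N ≤ m`, the factor `N * N` accounts for at most `2 * (Nat.log 2 m + 1)` further bits.
    calc N * N * 2 ^ (w m * s m)
        < 2 ^ (Nat.log 2 m + 1) * 2 ^ (Nat.log 2 m + 1) * 2 ^ (w m * s m) := by
          have := hNm'.trans_lt hpow
          refine Nat.mul_lt_mul_of_pos_right ?_ (by positivity)
          exact Nat.mul_lt_mul'' this this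
      _ = 2 ^ (2 * (Nat.log 2 m + 1) + w m * s m) := by ring
      _ ≤ 2 ^ textLength χ m := Nat.pow_le_pow_right (by norm_num) hn
  obtain ⟨N₀, hN₀⟩ := eventually_atTop.1
    (((tendsto_refLength hχ0 hχ1).eventually hinv).and
      ((mul_le_refLength hχ0 hχ1).and (eventually_gt_atTop 0)))
  -- The finitely many small `N` use a lookup table, which does not affect the asymptotics.
  let par : ℕ → ℕ × ℕ × ℕ := fun N => if N₀ ≤ N then
    (5 * addrBits w (refLength χ N) + 4, s (refLength χ N) + (s (refLength χ N) + 2),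
      inversionTime χ s tc tq (refLength χ N)) else (N + 2, N + 1, 3)
  refine ⟨fun N => (par N).1, fun N => (par N).2.1, fun N => (par N).2.2, ?_, ?_, ?_, fun N => ?_⟩
  · refine IsTheta.trans (EventuallyEq.isTheta ?_)
      (IsTheta.trans ⟨(isTheta_wordSize hw).1.comp_tendsto (tendsto_refLength hχ0 hχ1),
        (isTheta_wordSize hw).2.comp_tendsto (tendsto_refLength hχ0 hχ1)⟩
        (isTheta_log_refLength hχ0 hχ1))
    filter_upwards [eventually_ge_atTop N₀] with N hN
    simp [par, hN]
  · refine ((isSoftO_space hχ0 hw hs).comp_refLength hχ0 hχ1 hχ0.le).congr' ?_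
    filter_upwards [eventually_ge_atTop N₀] with N hN
    simp [par, hN]
  · refine ((isSoftO_inversionTime hχ0 hδ hw hs htq htc).comp_refLength hχ0 hχ1
      (by linarith)).congr' ?_
    filter_upwards [eventually_ge_atTop N₀] with N hN
    simp [par, hN]
  · by_cases hN : N₀ ≤ N
    · have hpar : par N = _ := if_pos hN
      change ∃ P : Program (par N).1 (par N).2.1, P.Inverts N (par N).2.2
      rw [hpar]
      obtain ⟨h1, h2, h3⟩ := hN₀ N hN
      exact h1 N h3 h2
    · have hpar : par N = _ := if_neg hN
      change ∃ P : Program (par N).1 (par N).2.1, P.Inverts N (par N).2.2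
      rw [hpar]
      exact exists_inverts N
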